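/- Let $G$ be a unipotent algebraic $\mathbb{Z}$-group, that is, an affine group scheme of finite type over $\mathbb{Z}$ whose generic fibre $G_{\mathbb{Q}}$ is a unipotent algebraic group (every nonzero finite-dimensional representation of $G_{\mathbb{Q}}$ over $\mathbb{Q}$ has a nonzero fixed vector). Consider $G(\mathbb{Z})$ as a subgroup of $G(\mathbb{R})$. For subgroups $\Delta_1,\Delta_2\le G(\mathbb{R})$ put $c(\Delta_1,\Delta_2)=[\Delta_1:\Delta_1\cap\Delta_2]\,[\Delta_2:\Delta_1\cap\Delta_2]$. Let $\mathcal{L}(G)$ be the set of arithmetic lattices of $G$, i.e. of all subgroups $\Delta\le G(\mathbb{R})$ with $c(G(\mathbb{Z}),\Delta)<\infty$, and for a prime $p$ let $\mathcal{L}_{(p)}(G)$ be the set of those $\Delta\in\mathcal{L}(G)$ for which $c(G(\mathbb{Z}),\Delta)$ is a power of $p$ (including $p^0=1$). For $\mathcal{F}\subseteq\mathcal{L}(G)$ and $n\ge 1$ let $c_n(\mathcal{F})$ be the number of $\Delta\in\mathcal{F}$ with $c(G(\mathbb{Z}),\Delta)=n$, let $\zeta_{\mathcal{F}}(s)=\sum_{n\ge1}c_n(\mathcal{F})\,n^{-s}$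 as a formal Dirichlet series, and put $\zeta_G=\zeta_{\mathcal{L}(G)}$ and $\zeta_{G,p}=\zeta_{\mathcal{L}_{(p)}(G)}$. Then $c_n(\mathcal{L}(G))$ is finite for every $n\ge1$, and $$\zeta_G(s)=\prod_{p\ \mathrm{prime}}\zeta_{G,p}(s)$$ as a formal product over all primes of Dirichlet series: for every $n\geq 1$, the coefficient of $n^{-s}$ in $\prod_{p\in S}\zeta_{G,p}(s)$ equals $c_n(\mathcal{L}(G))$ for all sufficiently large finite sets $S$ of primes. Equivalently, for every $n\ge 1$ with prime factorization $n=\prod_i p_i^{e_i}$, $$c_n(\mathcal{L}(G))=\prod_i c_{p_i^{e_i}}(\mathcal{L}(G)).$$ -/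

import Mathlib

open scoped TensorProduct

/-!
Affine group schemes of finite type over `ℤ` are given by their coordinate rings: commutative Hopf
algebras `A` that are finitely generated as rings, with `G = Spec A` and `G(R) = Hom(A, R)`.
The coordinate rings are declared as `CommSemiring`s: being algebras over `ℤ` or over a field they
are commutative rings, and the algebra structure over `ℤ` is then the one in the Hopf algebra.
-/

/-- A matrix representation `G → GL_m` of the affine group scheme `G = Spec B` over `K`, given by
its matrix of coordinate functions: `M(gh) = M(g) M(h)` and `M(1) = 1`. -/
def IsMatrixRep (K : Type*) {B : Type*} [Field K] [CommSemiring B] [HopfAlgebra K B] {m : ℕ}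
    (M : Matrix (Fin m) (Fin m) B) : Prop :=
  (∀ i j, Coalgebra.comul (R := K) (M i j) = ∑ k, M i k ⊗ₜ[K] M k j) ∧
    ∀ i j, Coalgebra.counit (R := K) (M i j) = if i = j then 1 else 0

/-- The affine group scheme `Spec B` over the field `K` is unipotent: every nonzero
finite-dimensional representation has a nonzero fixed vector. -/
def IsUnipotentGroup (K B : Type*) [Field K] [CommSemiring B] [HopfAlgebra K B] : Prop :=
  ∀ (m : ℕ) (M : Matrix (Fin m) (Fin m) B), 0 < m → IsMatrixRep K M →
    ∃ v : Fin m → K, v ≠ 0 ∧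
      M.mulVec (fun j => algebraMap K B (v j)) = fun i => algebraMap K B (v i)

/-- The commensurability index `[Δ₁ : Δ₁ ∩ Δ₂] [Δ₂ : Δ₁ ∩ Δ₂]`, with value `0` if it is infinite
(`H.relIndex K` is `[K : H ∩ K]`). -/
noncomputable def commIndex {Γ : Type*} [Group Γ] (Δ₁ Δ₂ : Subgroup Γ) : ℕ :=
  Δ₂.relIndex Δ₁ * Δ₁.relIndex Δ₂

section ZGroup

variable (A : Type*) [CommSemiring A] [HopfAlgebra ℤ A]

/-- `Spec A` is a unipotent algebraic group over `ℤ`: it is of finite type and its generic fibre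
is a unipotent group over `ℚ`. -/
def IsUnipotentZGroup : Prop :=
  Algebra.FiniteType ℤ A ∧ IsUnipotentGroup ℚ (ℚ ⊗[ℤ] A)

/-- The group `G(R) = Hom(A, R)` of `R`-points of `G = Spec A`; its group law is convolution. -/
abbrev GPoints (R : Type*) [CommRing R] : Type _ := WithConv (A →ₐ[ℤ] R)

/-- The group structure on `G(R)`: the monoid structure is Mathlib's convolution product, and the
inverse is composition with the antipode. -/
noncomputable instance GPoints.instGroup (R : Type*) [CommRing R] : Group (GPoints A R) where
  inv f := WithConv.toConv (f.ofConv.comp (HopfAlgebra.antipodeAlgHom ℤ A))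
  inv_mul_cancel f := by
    apply WithConv.ofConv_injective
    ext a
    have h := HopfAlgebra.sum_antipode_mul_eq_algebraMap_counit (Coalgebra.Repr.arbitrary ℤ a)
    have h2 := congrArg f.ofConv h
    simp only [map_sum, map_mul] at h2
    change (WithConv.toConv (f.ofConv.comp (HopfAlgebra.antipodeAlgHom ℤ A)) * f) a
      = (1 : GPoints A R) a
    rw [AlgHom.convMul_apply, AlgHom.convOne_apply, ← (Coalgebra.Repr.arbitrary ℤ a).eq]
    simpa using h2

/-- `G(ℤ)` as a subgroup of `G(ℝ)`: the real points that factor through `ℤ → ℝ`. -/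
def integralPoints : Subgroup (GPoints A ℝ) where
  carrier := {g | ∃ h : GPoints A ℤ, g = WithConv.toConv ((Algebra.ofId ℤ ℝ).comp h.ofConv)}
  one_mem' := by
    refine ⟨1, ?_⟩
    apply WithConv.ofConv_injective
    ext a
    simp [AlgHom.convOne_def]
  mul_mem' := by
    rintro _ _ ⟨h, rfl⟩ ⟨k, rfl⟩
    refine ⟨h * k, ?_⟩
    rw [AlgHom.comp_convMul_distrib]
  inv_mem' := by
    rintro _ ⟨h, rfl⟩
    exact ⟨h⁻¹, rfl⟩

/-- `𝓛(G)`: the arithmetic lattices, i.e. the subgroups of `G(ℝ)` commensurable with `G(ℤ)`. -/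
def arithmeticLattices : Set (Subgroup (GPoints A ℝ)) :=
  {Δ | Subgroup.Commensurable Δ (integralPoints A)}

/-- `𝓛_(p)(G)`: the arithmetic lattices whose commensurability index with `G(ℤ)` is a power
of `p`. -/
def localLattices (p : ℕ) : Set (Subgroup (GPoints A ℝ)) :=
  {Δ | Δ ∈ arithmeticLattices A ∧ ∃ k : ℕ, commIndex (integralPoints A) Δ = p ^ k}

variable {A}

/-- `c_n(F)`: the number of members of the family `F` of commensurability index `n` with `G(ℤ)`
(a cardinality of a finite set whenever it is used). -/
noncomputable def commCount (F : Set (Subgroup (GPoints A ℝ))) (n : ℕ) : ℕ :=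
  Set.ncard {Δ | Δ ∈ F ∧ commIndex (integralPoints A) Δ = n}

/-- The formal Dirichlet series `ζ_F(s) = ∑_{n ≥ 1} c_n(F) n^{-s}`; formal Dirichlet series are
arithmetic functions, multiplied by Dirichlet convolution. -/
noncomputable def commZeta (F : Set (Subgroup (GPoints A ℝ))) : ArithmeticFunction ℕ where
  toFun n := if n = 0 then 0 else commCount F n
  map_zero' := if_pos rfl

end ZGroup

/-- `g = ∏_p f_p` as a formal product over all primes of Dirichlet series: each coefficient of the
finite partial products is eventually equal to that of `g`. -/
def IsFormalPrimeProduct (f : Nat.Primes → ArithmeticFunction ℕ) (g : ArithmeticFunction ℕ) :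
    Prop :=
  ∀ n : ℕ, ∀ᶠ S : Finset Nat.Primes in Filter.atTop, (∏ p ∈ S, f p) n = g n

/-!
The proof has three ingredients, for `Γ = G(ℝ)` and `L = G(ℤ)`.

*Unipotence.* Finitely many elements of a coalgebra over a field lie in a finite-dimensional
subcomodule (`exists_finiteDimensional_comul_mem_range`), so the generic fibre has a matrix
representation whose coefficients span a space containing generators of the coordinate ring, and
`Γ` acts faithfully in it. Dividing out fixed vectors one after the other shows that products of
`m` factors `ρ(x) - 1` vanish (`IsUnipotentGroup.prod_map_sub_one_mulVec`). Hence `Γ` is nilpotent,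
and the binomial series gives real powers of the elements of `Γ`; these stay in `Γ` because the
coordinates of `x ^ t` are polynomials in `t` (`exists_pow_eq_and_pointRep_eq`).

*Finiteness* (`IsUnipotentZGroup.finite_commIndex_eq`). Let `Δ` have commensurability index `n`, and
put `r = n!`. The `r`-th powers of elements of `Δ` lie in `L`, so the elements of `Δ`, being roots
of matrices of bounded denominator, have bounded denominator. An element that is sufficiently
congruent to `1` is the `r`-th power of an element of `L`, so it lies in `Δ`. Thus `Δ` is a union of cosets of
a fixed congruence subgroup in a set of elements of bounded denominator, where there are finitely
many.

*Multiplicativity* (`card_commIndex_mul`). In a nilpotent group the elements with a power in `H` of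
exponent in a multiplicative set `S` form a subgroup, the isolator of `H`, because commutators are
bilinear along the lower central series (`exists_pow_mem_of_closure_eq_top`). For coprime `a` and
`b` let `T` be the set of divisors of powers of `a` and `S` the set of integers prime to `a`. A
subgroup is the intersection of its `S`- and its `T`-isolator, and commensurability indices are
the product of the indices of the isolators, which are their `T`- and `S`-parts
(`IsComplementaryPair.commIndex_eq_mul`). Therefore the subgroups of index `a b` correspond to pairs
of subgroups of index `a` and `b` (`IsComplementaryPair.commIndexEquiv`). The Euler product is the
formal consequence `isFormalPrimeProduct_of_isMultiplicative` of multiplicativity.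
-/

/-! ### Isolators in nilpotent groups -/

section Isolator

open scoped commutatorElement

variable {G : Type*} [Group G]

open Subgroup

/-- For `a ∈ γ_n` the commutators `⁅a, b⁆` are central modulo `γ_{n+2}`, so `⁅a, b⁆` is
multiplicative in `b` there. Together with multiplicativity in `a` this makes the commutator a
bilinear map from `γ_n × G` to `γ_{n+1} / γ_{n+2}`. Indices count from `γ_0 = G`. -/
theorem mk_commutator_mul_right {n : ℕ} {a : G}
    (ha : a ∈ (⊤ : Subgroup G).lowerCentralSeries n) (b c : G) :
    (QuotientGroup.mk ⁅a, b * c⁆ : G ⧸ (⊤ : Subgroup G).lowerCentralSeries (n + 2)) =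
      QuotientGroup.mk ⁅a, b⁆ * QuotientGroup.mk ⁅a, c⁆ := by
  rw [← QuotientGroup.mk_mul, eq_comm, QuotientGroup.eq]
  have h1 : ⁅a, c⁆ ∈ (⊤ : Subgroup G).lowerCentralSeries (n + 1) :=
    commutator_mem_commutator ha (mem_top c)
  have h2 : ⁅⁅a, c⁆⁻¹, b⁆ ∈ (⊤ : Subgroup G).lowerCentralSeries (n + 2) :=
    commutator_mem_commutator (inv_mem h1) (mem_top b)
  convert h2 using 1
  simp only [commutatorElement_def]
  group

theorem mk_commutator_mul_left {n : ℕ} {a c : G}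
    (hc : c ∈ (⊤ : Subgroup G).lowerCentralSeries n) (b : G) :
    (QuotientGroup.mk ⁅a * c, b⁆ : G ⧸ (⊤ : Subgroup G).lowerCentralSeries (n + 2)) =
      QuotientGroup.mk ⁅a, b⁆ * QuotientGroup.mk ⁅c, b⁆ := by
  rw [← QuotientGroup.mk_mul, eq_comm, QuotientGroup.eq]
  have h1 : ⁅c, b⁆ ∈ (⊤ : Subgroup G).lowerCentralSeries (n + 1) :=
    commutator_mem_commutator hc (mem_top b)
  have h2 : ⁅⁅c, b⁆⁻¹, ⁅a, b⁆⁻¹ * a⁆ ∈ (⊤ : Subgroup G).lowerCentralSeries (n + 2) :=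
    commutator_mem_commutator (inv_mem h1) (mem_top _)
  convert h2 using 1
  simp only [commutatorElement_def]
  group

/-- If all commutators `⁅a, b⁆` are central modulo `N`, then `b ↦ ⁅a, b⁆` is a homomorphism to an
abelian group modulo `N`, and does not see the commutator subgroup. -/
theorem mk_commutator_eq_of_inv_mul_mem_commutator (N : Subgroup G) [N.Normal] {a : G}
    (ha : ∀ b g : G, ⁅⁅a, b⁆⁻¹, g⁆ ∈ N) {b c : G} (hbc : b⁻¹ * c ∈ _root_.commutator G) :
    (QuotientGroup.mk ⁅a, b⁆ : G ⧸ N) = QuotientGroup.mk ⁅a, c⁆ := by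
  let φ : G →* G ⧸ N := MonoidHom.mk' (fun b => QuotientGroup.mk ⁅a, b⁆) (fun b c => by
    rw [← QuotientGroup.mk_mul, eq_comm, QuotientGroup.eq]
    convert ha c b using 1
    simp only [commutatorElement_def]
    group)
  have hcomm : ∀ b c : G, Commute (φ b) (φ c) := fun b c => by
    change QuotientGroup.mk ⁅a, b⁆ * QuotientGroup.mk ⁅a, c⁆ =
      (QuotientGroup.mk ⁅a, c⁆ * QuotientGroup.mk ⁅a, b⁆ : G ⧸ N)
    rw [← QuotientGroup.mk_mul, ← QuotientGroup.mk_mul, eq_comm, QuotientGroup.eq]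
    convert ha b ⁅a, c⁆⁻¹ using 1
    simp only [commutatorElement_def]
    group
  have hle : _root_.commutator G ≤ φ.ker := by
    refine Subgroup.commutator_le.2 fun x _ y _ => ?_
    rw [MonoidHom.mem_ker, map_commutatorElement, commutatorElement_eq_one_iff_commute]
    exact hcomm x y
  have hker := hle hbc
  rw [MonoidHom.mem_ker, map_mul, map_inv, inv_mul_eq_one] at hker
  exact hker

/-- Modulo `γ_{n+2}`, the commutator with an element of `γ_n` does not see `γ_1`. -/
theorem mk_commutator_eq_of_mk_eq_right {n : ℕ} {a : G}
    (ha : a ∈ (⊤ : Subgroup G).lowerCentralSeries n) {b c : G}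
    (hbc : (QuotientGroup.mk b : G ⧸ (⊤ : Subgroup G).lowerCentralSeries 1) = QuotientGroup.mk c) :
    (QuotientGroup.mk ⁅a, b⁆ : G ⧸ (⊤ : Subgroup G).lowerCentralSeries (n + 2)) =
      QuotientGroup.mk ⁅a, c⁆ :=
  mk_commutator_eq_of_inv_mul_mem_commutator _ (fun b g => commutator_mem_commutator
    (inv_mem (commutator_mem_commutator ha (mem_top b))) (mem_top g)) (QuotientGroup.eq.1 hbc)

/-- Modulo `γ_{n+2}`, the commutator does not see `γ_{n+1}` in its first argument. -/
theorem mk_commutator_eq_of_mk_eq_left {n : ℕ} {a c : G}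
    (hac : (QuotientGroup.mk a : G ⧸ (⊤ : Subgroup G).lowerCentralSeries (n + 1)) =
      QuotientGroup.mk c) (b : G) :
    (QuotientGroup.mk ⁅a, b⁆ : G ⧸ (⊤ : Subgroup G).lowerCentralSeries (n + 2)) =
      QuotientGroup.mk ⁅c, b⁆ := by
  have h := QuotientGroup.eq.1 hac
  have h1 : ⁅a⁻¹ * c, b⁆ ∈ (⊤ : Subgroup G).lowerCentralSeries (n + 2) :=
    commutator_mem_commutator h (mem_top b)
  have h2 := mk_commutator_mul_left (a := a)
    ((⊤ : Subgroup G).lowerCentralSeries_antitone (Nat.le_succ n) h) b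
  rw [mul_inv_cancel_left, (QuotientGroup.eq_one_iff _).2 h1, mul_one] at h2
  exact h2.symm

theorem mk_commutator_pow {n : ℕ} {a : G}
    (ha : a ∈ (⊤ : Subgroup G).lowerCentralSeries n) (b : G) (k l : ℕ) :
    (QuotientGroup.mk ⁅a ^ k, b ^ l⁆ : G ⧸ (⊤ : Subgroup G).lowerCentralSeries (n + 2)) =
      QuotientGroup.mk ⁅a, b⁆ ^ (k * l) := by
  have hk : ∀ b : G, (QuotientGroup.mk ⁅a ^ k, b⁆ :
      G ⧸ (⊤ : Subgroup G).lowerCentralSeries (n + 2)) = QuotientGroup.mk ⁅a, b⁆ ^ k := by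
    intro b
    induction k with
    | zero => rw [pow_zero, pow_zero, commutatorElement_one_left, QuotientGroup.mk_one]
    | succ k ih => rw [pow_succ, mk_commutator_mul_left ha, ih, pow_succ]
  have hl : (QuotientGroup.mk ⁅a, b ^ l⁆ :
      G ⧸ (⊤ : Subgroup G).lowerCentralSeries (n + 2)) = QuotientGroup.mk ⁅a, b⁆ ^ l := by
    induction l with
    | zero => rw [pow_zero, pow_zero, commutatorElement_one_right, QuotientGroup.mk_one]
    | succ l ih => rw [pow_succ, mk_commutator_mul_right ha, ih, pow_succ]
  rw [hk, hl, ← pow_mul, mul_comm]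

theorem mk_commute_of_mem_lowerCentralSeries {n : ℕ} {a : G}
    (ha : a ∈ (⊤ : Subgroup G).lowerCentralSeries n) (b : G) :
    Commute (QuotientGroup.mk a : G ⧸ (⊤ : Subgroup G).lowerCentralSeries (n + 1))
      (QuotientGroup.mk b) := by
  have h1 : ⁅a, b⁆ ∈ (⊤ : Subgroup G).lowerCentralSeries (n + 1) :=
    commutator_mem_commutator ha (mem_top b)
  rw [← QuotientGroup.eq_one_iff, commutatorElement_def] at h1
  simp only [QuotientGroup.mk_mul, QuotientGroup.mk_inv] at h1
  rw [mul_inv_eq_one, mul_inv_eq_iff_eq_mul] at h1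
  exact h1

/-- As `γ_i` is central modulo `γ_{i+1}`, it suffices to find `S`-powers in `H` modulo `γ_{i+1}` for
the elements of a generating set of `γ_i`. -/
theorem exists_pow_mk_eq_of_closure (S : Submonoid ℕ) (H : Subgroup G) (i : ℕ) {Y : Set G}
    (hY : (⊤ : Subgroup G).lowerCentralSeries i = closure Y)
    (hYH : ∀ g ∈ Y, ∃ m ∈ S, ∃ h ∈ H, h ∈ (⊤ : Subgroup G).lowerCentralSeries i ∧
      (QuotientGroup.mk (g ^ m) : G ⧸ (⊤ : Subgroup G).lowerCentralSeries (i + 1)) =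
        QuotientGroup.mk h) :
    ∀ g ∈ (⊤ : Subgroup G).lowerCentralSeries i, ∃ m ∈ S, ∃ h ∈ H,
      h ∈ (⊤ : Subgroup G).lowerCentralSeries i ∧
      (QuotientGroup.mk (g ^ m) : G ⧸ (⊤ : Subgroup G).lowerCentralSeries (i + 1)) =
        QuotientGroup.mk h := by
  intro g hg
  rw [hY] at hg
  induction hg using closure_induction with
  | mem x hx => exact hYH x hx
  | one => exact ⟨1, S.one_mem, 1, H.one_mem, one_mem _, by simp⟩
  | mul x y hx hy ihx ihy =>
    obtain ⟨m, hm, h, hH, hi, e⟩ := ihx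
    obtain ⟨m', hm', h', hH', hi', e'⟩ := ihy
    refine ⟨m * m', S.mul_mem hm hm', h ^ m' * h' ^ m,
      H.mul_mem (H.pow_mem hH _) (H.pow_mem hH' _),
      mul_mem (pow_mem hi _) (pow_mem hi' _), ?_⟩
    have hc := mk_commute_of_mem_lowerCentralSeries (hY ▸ hx) y
    rw [QuotientGroup.mk_pow, QuotientGroup.mk_mul, hc.mul_pow, pow_mul, ← QuotientGroup.mk_pow,
      e, mul_comm m, pow_mul, ← QuotientGroup.mk_pow _ y, e', QuotientGroup.mk_mul,
      QuotientGroup.mk_pow, QuotientGroup.mk_pow]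
  | inv x hx ih =>
    obtain ⟨m, hm, h, hH, hi, e⟩ := ih
    exact ⟨m, hm, h⁻¹, H.inv_mem hH, inv_mem hi, by
      rw [inv_pow, QuotientGroup.mk_inv, e, QuotientGroup.mk_inv]⟩

/-- If the generators of `G` have an `S`-power in `H`, so has every element of `γ_i`,
modulo `γ_{i+1}`. -/
theorem exists_pow_mk_eq_of_mem_lowerCentralSeries (S : Submonoid ℕ) (H : Subgroup G) {X : Set G}
    (hX : closure X = ⊤) (hXH : ∀ x ∈ X, ∃ m ∈ S, x ^ m ∈ H) (i : ℕ) :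
    ∀ g ∈ (⊤ : Subgroup G).lowerCentralSeries i, ∃ m ∈ S, ∃ h ∈ H,
      h ∈ (⊤ : Subgroup G).lowerCentralSeries i ∧
      (QuotientGroup.mk (g ^ m) : G ⧸ (⊤ : Subgroup G).lowerCentralSeries (i + 1)) =
        QuotientGroup.mk h := by
  have h0 : ∀ g ∈ (⊤ : Subgroup G).lowerCentralSeries 0, ∃ m ∈ S, ∃ h ∈ H,
      h ∈ (⊤ : Subgroup G).lowerCentralSeries 0 ∧
      (QuotientGroup.mk (g ^ m) : G ⧸ (⊤ : Subgroup G).lowerCentralSeries (0 + 1)) =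
        QuotientGroup.mk h := by
    refine exists_pow_mk_eq_of_closure S H 0 hX.symm fun x hx => ?_
    obtain ⟨m, hm, h⟩ := hXH x hx
    exact ⟨m, hm, _, h, mem_top _, rfl⟩
  induction i with
  | zero => exact h0
  | succ i ih =>
    refine exists_pow_mk_eq_of_closure S H (i + 1) rfl ?_
    rintro _ ⟨a, ha, b, -, rfl⟩
    obtain ⟨m, hm, h, hH, hi, e⟩ := ih a ha
    obtain ⟨m', hm', h', hH', -, e'⟩ := h0 b (mem_top b)
    -- Bilinearity turns `a ^ m ≡ h` and `b ^ m' ≡ h'` into `⁅a, b⁆ ^ (m * m') ≡ ⁅h, h'⁆`.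
    refine ⟨m * m', S.mul_mem hm hm', ⁅h, h'⁆,
      H.mul_mem (H.mul_mem (H.mul_mem hH hH') (H.inv_mem hH)) (H.inv_mem hH'),
      commutator_mem_commutator hi (mem_top _), ?_⟩
    rw [QuotientGroup.mk_pow, ← mk_commutator_pow ha, mk_commutator_eq_of_mk_eq_left e,
      mk_commutator_eq_of_mk_eq_right hi e']

/-- In a nilpotent group, if the generators have an `S`-power in `H`, so has every element. -/
theorem exists_pow_mem_of_closure_eq_top [Group.IsNilpotent G] (S : Submonoid ℕ) (H : Subgroup G)
    {X : Set G} (hX : closure X = ⊤) (hXH : ∀ x ∈ X, ∃ m ∈ S, x ^ m ∈ H) (g : G) :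
    ∃ m ∈ S, g ^ m ∈ H := by
  obtain ⟨c, hc⟩ := (Subgroup.nilpotent_iff_lowerCentralSeries (G := G)).1 inferInstance
  have key : ∀ i, ∃ m ∈ S, ∃ h ∈ H,
      (QuotientGroup.mk (g ^ m) : G ⧸ (⊤ : Subgroup G).lowerCentralSeries i) =
        QuotientGroup.mk h := by
    intro i
    induction i with
    | zero => exact ⟨1, S.one_mem, 1, H.one_mem, QuotientGroup.eq.2 (mem_top _)⟩
    | succ i ih =>
      obtain ⟨m, hm, h, hH, e⟩ := ih
      have hz : h⁻¹ * g ^ m ∈ (⊤ : Subgroup G).lowerCentralSeries i := QuotientGroup.eq.1 e.symm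
      obtain ⟨m', hm', h', hH', hi', e'⟩ :=
        exists_pow_mk_eq_of_mem_lowerCentralSeries S H hX hXH i _ hz
      refine ⟨m * m', S.mul_mem hm hm', h ^ m' * h', H.mul_mem (H.pow_mem hH _) hH', ?_⟩
      have hcomm := (mk_commute_of_mem_lowerCentralSeries hz h).symm
      have hg : g ^ m = h * (h⁻¹ * g ^ m) := by group
      rw [pow_mul, hg, QuotientGroup.mk_pow, QuotientGroup.mk_mul, hcomm.mul_pow,
        ← QuotientGroup.mk_pow, ← QuotientGroup.mk_pow, e', ← QuotientGroup.mk_mul]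
  obtain ⟨m, hm, h, hH, e⟩ := key c
  have h1 := QuotientGroup.eq.1 e.symm
  rw [hc, mem_bot, inv_mul_eq_one] at h1
  exact ⟨m, hm, h1 ▸ hH⟩

/-- Applied to the subgroup generated by `x` and `y`, the preceding lemma shows that having an
`S`-power in `H` is stable under products. -/
theorem exists_mul_pow_mem [Group.IsNilpotent G] (S : Submonoid ℕ) (H : Subgroup G) {x y : G}
    (hx : ∃ m ∈ S, x ^ m ∈ H) (hy : ∃ m ∈ S, y ^ m ∈ H) : ∃ m ∈ S, (x * y) ^ m ∈ H := by
  have hxK : x ∈ closure {x, y} := subset_closure (by simp)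
  have hyK : y ∈ closure {x, y} := subset_closure (by simp)
  obtain ⟨m, hm, h⟩ := exists_pow_mem_of_closure_eq_top (G := closure {x, y}) S
    (H.subgroupOf (closure {x, y})) (closure_closure_coe_preimage) (by
      rintro ⟨z, hz⟩ hz'
      rcases (show z = x ∨ z = y from hz') with rfl | rfl
      · exact hx
      · exact hy) (⟨x, hxK⟩ * ⟨y, hyK⟩)
  exact ⟨m, hm, h⟩

variable [Group.IsNilpotent G]

/-- The `S`-isolator of a subgroup `H` of a nilpotent group: the elements with a power in `H` whose
exponent lies in the multiplicative set `S`. -/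
def isolator (S : Submonoid ℕ) (H : Subgroup G) : Subgroup G where
  carrier := {x | ∃ m ∈ S, x ^ m ∈ H}
  one_mem' := ⟨1, S.one_mem, by simp⟩
  inv_mem' := by
    rintro x ⟨m, hm, h⟩
    exact ⟨m, hm, by rw [inv_pow]; exact H.inv_mem h⟩
  mul_mem' := exists_mul_pow_mem S H

theorem le_isolator (S : Submonoid ℕ) (H : Subgroup G) : H ≤ isolator S H :=
  fun x hx => ⟨1, S.one_mem, by simpa using hx⟩

theorem isolator_mono (S : Submonoid ℕ) {H K : Subgroup G} (h : H ≤ K) :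
    isolator S H ≤ isolator S K := fun _ ⟨m, hm, hx⟩ => ⟨m, hm, h hx⟩

theorem isolator_inf (S : Submonoid ℕ) (H K : Subgroup G) :
    isolator S (H ⊓ K) = isolator S H ⊓ isolator S K := by
  refine le_antisymm (le_inf (isolator_mono S inf_le_left) (isolator_mono S inf_le_right)) ?_
  rintro x ⟨⟨m, hm, h⟩, ⟨m', hm', h'⟩⟩
  refine ⟨m * m', S.mul_mem hm hm', ?_, ?_⟩
  · rw [pow_mul]; exact H.pow_mem h _
  · rw [mul_comm, pow_mul]; exact K.pow_mem h' _

theorem isolator_isolator (S : Submonoid ℕ) (H : Subgroup G) :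
    isolator S (isolator S H) = isolator S H := by
  refine le_antisymm ?_ (le_isolator S _)
  rintro x ⟨m, hm, m', hm', h⟩
  exact ⟨m * m', S.mul_mem hm hm', by rwa [pow_mul]⟩

end Isolator

/-! ### Splitting commensurability indices along coprime factors -/

section Splitting

open Subgroup

/-- Two multiplicative sets `S`, `T` of positive integers are complementary if every positive
integer is a product of an element of `S` and an element of `T`, and the two are always coprime. -/
structure IsComplementaryPair (S T : Submonoid ℕ) : Prop where
  zero_notMem_left : 0 ∉ S
  zero_notMem_right : 0 ∉ T
  coprime : ∀ s ∈ S, ∀ t ∈ T, s.Coprime t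
  exists_eq_mul : ∀ n : ℕ, n ≠ 0 → ∃ s ∈ S, ∃ t ∈ T, n = s * t

theorem IsComplementaryPair.symm {S T : Submonoid ℕ} (h : IsComplementaryPair S T) :
    IsComplementaryPair T S where
  zero_notMem_left := h.zero_notMem_right
  zero_notMem_right := h.zero_notMem_left
  coprime s hs t ht := (h.coprime t ht s hs).symm
  exists_eq_mul n hn := by
    obtain ⟨s, hs, t, ht, e⟩ := h.exists_eq_mul n hn
    exact ⟨t, ht, s, hs, by rw [e, mul_comm]⟩

/-- The positive integers coprime to `a`. -/
def coprimeSubmonoid (a : ℕ) : Submonoid ℕ where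
  carrier := {m | m ≠ 0 ∧ m.Coprime a}
  one_mem' := ⟨one_ne_zero, Nat.coprime_one_left a⟩
  mul_mem' := fun h h' => ⟨mul_ne_zero h.1 h'.1, Nat.Coprime.mul_left h.2 h'.2⟩

/-- The positive integers all of whose prime factors divide `a`, as the divisors of powers of
`a`. -/
def powDvdSubmonoid (a : ℕ) : Submonoid ℕ where
  carrier := {m | m ≠ 0 ∧ ∃ k, m ∣ a ^ k}
  one_mem' := ⟨one_ne_zero, 0, one_dvd _⟩
  mul_mem' := by
    rintro m n ⟨hm, k, hk⟩ ⟨hn, l, hl⟩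
    exact ⟨mul_ne_zero hm hn, k + l, by rw [pow_add]; exact mul_dvd_mul hk hl⟩

theorem isComplementaryPair_coprime_powDvd (a : ℕ) :
    IsComplementaryPair (coprimeSubmonoid a) (powDvdSubmonoid a) where
  zero_notMem_left h := h.1 rfl
  zero_notMem_right h := h.1 rfl
  coprime := by
    rintro s ⟨-, hs⟩ t ⟨-, k, hk⟩
    exact (hs.pow_right k).coprime_dvd_right hk
  exists_eq_mul := by
    intro n
    induction n using Nat.recOnMul with
    | zero => intro h; exact absurd rfl h
    | one => intro _; exact ⟨1, one_mem _, 1, one_mem _, rfl⟩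
    | prime p hp =>
      intro h
      by_cases hpa : p ∣ a
      · exact ⟨1, one_mem _, p, ⟨h, 1, by simpa using hpa⟩, by simp⟩
      · exact ⟨p, ⟨h, (Nat.Prime.coprime_iff_not_dvd hp).2 hpa⟩, 1, one_mem _, by simp⟩
    | mul m n ihm ihn =>
      intro h
      obtain ⟨s, hs, t, ht, rfl⟩ := ihm (left_ne_zero_of_mul h)
      obtain ⟨s', hs', t', ht', rfl⟩ := ihn (right_ne_zero_of_mul h)
      exact ⟨s * s', mul_mem hs hs', t * t', mul_mem ht ht', by ring⟩

variable {G : Type*} [Group G]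

/-- Bézout: for coprime `s`, `t` every element is a product of an `s`-th and a `t`-th power of
itself. -/
theorem exists_eq_zpow_mul_zpow {s t : ℕ} (h : s.Coprime t) (x : G) :
    ∃ u v : ℤ, x = (x ^ s) ^ u * (x ^ t) ^ v := by
  refine ⟨s.gcdA t, s.gcdB t, ?_⟩
  have h1 := Nat.gcd_eq_gcd_ab s t
  rw [Nat.coprime_iff_gcd_eq_one.1 h] at h1
  rw [← zpow_natCast, ← zpow_natCast, ← zpow_mul, ← zpow_mul, ← zpow_add, ← h1, Nat.cast_one,
    zpow_one]

theorem mem_of_pow_mem_of_coprime {H : Subgroup G} {s t : ℕ} (h : s.Coprime t) {x : G}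
    (hs : x ^ s ∈ H) (ht : x ^ t ∈ H) : x ∈ H := by
  obtain ⟨u, v, e⟩ := exists_eq_zpow_mul_zpow h x
  rw [e]
  exact mul_mem (zpow_mem hs u) (zpow_mem ht v)

/-- If every element has a power of exponent prime to `q` in `C`, then `C` contains a Sylow
`q`-subgroup modulo its normal core, so `q` does not divide the index of `C`. -/
theorem not_dvd_index_of_forall_exists_pow_mem {C : Subgroup G} (hC : C.index ≠ 0) {q : ℕ}
    (hq : q.Prime) (h : ∀ x : G, ∃ t : ℕ, q.Coprime t ∧ x ^ t ∈ C) : ¬ q ∣ C.index := by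
  have : Fact q.Prime := ⟨hq⟩
  have : C.FiniteIndex := ⟨hC⟩
  have : Finite (G ⧸ C.normalCore) := Subgroup.finite_quotient_of_finiteIndex
  have hidx : (C.map (QuotientGroup.mk' C.normalCore)).index = C.index := by
    refine Subgroup.index_map_eq _ (QuotientGroup.mk'_surjective _) ?_
    rw [QuotientGroup.ker_mk']
    exact Subgroup.normalCore_le C
  let P : Sylow q (G ⧸ C.normalCore) := default
  have hP : (P : Subgroup (G ⧸ C.normalCore)) ≤ C.map (QuotientGroup.mk' C.normalCore) := by
    intro x hx
    obtain ⟨k, hk⟩ := P.isPGroup' ⟨x, hx⟩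
    have hk' : x ^ q ^ k = 1 := congrArg Subtype.val hk
    obtain ⟨g, rfl⟩ := QuotientGroup.mk'_surjective _ x
    obtain ⟨t, ht, hg⟩ := h g
    refine mem_of_pow_mem_of_coprime (ht.pow_left k) (hk' ▸ one_mem _) ?_
    rw [← map_pow]
    exact mem_map_of_mem _ hg
  rw [← hidx]
  intro hdvd
  exact P.not_dvd_index (hdvd.trans (index_dvd_of_le hP))

theorem not_dvd_relIndex_of_forall_exists_pow_mem {C A : Subgroup G} (hC : C.relIndex A ≠ 0) {q : ℕ}
    (hq : q.Prime) (h : ∀ x ∈ A, ∃ t : ℕ, q.Coprime t ∧ x ^ t ∈ C) : ¬ q ∣ C.relIndex A := by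
  refine not_dvd_index_of_forall_exists_pow_mem (C := C.subgroupOf A) hC hq ?_
  rintro ⟨x, hx⟩
  obtain ⟨t, ht, hxt⟩ := h x hx
  exact ⟨t, ht, hxt⟩

/-- If `B = A C` for `A ≤ B`, then `C` has the same relative index in `A` and in `B`. -/
theorem relIndex_eq_of_forall_exists_mul {A B C : Subgroup G} (hAB : A ≤ B)
    (h : ∀ x ∈ B, ∃ y ∈ A, ∃ z ∈ C, x = y * z) : C.relIndex A = C.relIndex B := by
  refine Nat.card_congr (Equiv.ofBijective (quotientSubgroupOfEmbeddingOfLE C hAB)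
    ⟨(quotientSubgroupOfEmbeddingOfLE C hAB).injective, ?_⟩)
  intro q
  obtain ⟨⟨x, hx⟩, rfl⟩ := QuotientGroup.mk_surjective q
  obtain ⟨y, hy, z, hz, rfl⟩ := h x hx
  refine ⟨QuotientGroup.mk ⟨y, hy⟩, ?_⟩
  rw [quotientSubgroupOfEmbeddingOfLE_apply_mk, QuotientGroup.eq, mem_subgroupOf]
  simpa using hz

theorem commIndex_ne_zero_iff {H K : Subgroup G} : commIndex H K ≠ 0 ↔ Commensurable K H := by
  rw [commIndex, mul_ne_zero_iff]
  rfl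

theorem commIndex_self (H : Subgroup G) : commIndex H H = 1 := by simp [commIndex]

theorem commIndex_eq_one_iff {H K : Subgroup G} : commIndex H K = 1 ↔ K = H := by
  rw [commIndex, mul_eq_one, relIndex_eq_one, relIndex_eq_one]
  exact ⟨fun h => le_antisymm h.2 h.1, fun h => by simp [h]⟩

variable [Group.IsNilpotent G] {S T : Submonoid ℕ}

/-- A subgroup is recovered from its two complementary isolators. -/
theorem IsComplementaryPair.isolator_inf_isolator (h : IsComplementaryPair S T) (H : Subgroup G) :
    isolator S H ⊓ isolator T H = H := by
  refine le_antisymm ?_ (le_inf (le_isolator S H) (le_isolator T H))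
  rintro x ⟨⟨s, hs, hxs⟩, ⟨t, ht, hxt⟩⟩
  exact mem_of_pow_mem_of_coprime (h.coprime s hs t ht) hxs hxt

/-- Passing from `isolator S H₁` to its intersection with `isolator T K` does not change the
relative index of `isolator S H₂`, for commensurable `H₁`, `H₂`, `K`. -/
theorem IsComplementaryPair.relIndex_inf_isolator (h : IsComplementaryPair S T)
    {H₁ H₂ K : Subgroup G} (h2 : H₂.relIndex H₁ ≠ 0) (hK : K.relIndex H₁ ≠ 0) :
    (isolator S H₂).relIndex (isolator S H₁ ⊓ isolator T K) =
      (isolator S H₂).relIndex (isolator S H₁) := by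
  refine relIndex_eq_of_forall_exists_mul inf_le_left ?_
  intro x hx
  obtain ⟨m, hm, hxm⟩ := hx
  have hm0 : m ≠ 0 := fun h0 => h.zero_notMem_left (h0 ▸ hm)
  obtain ⟨n, hn, -, hxn⟩ := exists_pow_mem_of_relIndex_ne_zero h2 hxm
  obtain ⟨k, hk, -, hxk⟩ := exists_pow_mem_of_relIndex_ne_zero hK hxm
  obtain ⟨s, hs, t, ht, e⟩ := h.exists_eq_mul (m * n * k) (by positivity)
  have hx2 : x ^ (s * t) ∈ H₂ := by
    rw [← e, pow_mul, pow_mul]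
    exact pow_mem hxn.1 k
  have hxK : x ^ (s * t) ∈ K := by
    rw [← e, mul_right_comm, pow_mul, pow_mul]
    exact pow_mem hxk.1 n
  obtain ⟨u, v, e'⟩ := exists_eq_zpow_mul_zpow (h.coprime s hs t ht) x
  have hxs : x ^ s ∈ isolator S H₁ ⊓ isolator T K :=
    ⟨(isolator S H₁).pow_mem ⟨m, hm, hxm⟩ s, t, ht, by rwa [← pow_mul]⟩
  have hxt : x ^ t ∈ isolator S H₂ := ⟨s, hs, by rwa [← pow_mul, mul_comm]⟩
  exact ⟨(x ^ s) ^ u, zpow_mem hxs u, (x ^ t) ^ v, zpow_mem hxt v, e'⟩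

theorem IsComplementaryPair.relIndex_isolator_ne_zero (h : IsComplementaryPair S T)
    {H₁ H₂ : Subgroup G} (h2 : H₂.relIndex H₁ ≠ 0) :
    (isolator S H₂).relIndex (isolator S H₁) ≠ 0 := by
  rw [← h.relIndex_inf_isolator h2 (K := H₁) (by simp), h.isolator_inf_isolator]
  exact ne_zero_of_dvd_ne_zero h2 (relIndex_dvd_of_le_left _ (le_isolator S H₂))

/-- Elements of `isolator S H₁` have `T`-powers in `isolator S H₂`, so by Sylow theory the index of
the latter is a `T`-number. -/
theorem IsComplementaryPair.relIndex_isolator_mem (h : IsComplementaryPair S T)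
    {H₁ H₂ : Subgroup G} (h2 : H₂.relIndex H₁ ≠ 0) :
    (isolator S H₂).relIndex (isolator S H₁) ∈ T := by
  have h0 := h.relIndex_isolator_ne_zero h2
  obtain ⟨s, hs, t, ht, e⟩ := h.exists_eq_mul _ h0
  suffices hs1 : s = 1 by rwa [e, hs1, one_mul]
  by_contra hs1
  obtain ⟨q, hq, hqs⟩ := Nat.exists_prime_and_dvd hs1
  refine not_dvd_relIndex_of_forall_exists_pow_mem h0 hq ?_ (e ▸ hqs.mul_right t)
  rintro x ⟨m, hm, hxm⟩
  have hm0 : m ≠ 0 := fun h0 => h.zero_notMem_left (h0 ▸ hm)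
  obtain ⟨n, hn, -, hxn⟩ := exists_pow_mem_of_relIndex_ne_zero h2 hxm
  obtain ⟨s', hs', t', ht', e'⟩ := h.exists_eq_mul (m * n) (by positivity)
  refine ⟨t', (h.coprime s hs t' ht').coprime_dvd_left hqs, s', hs', ?_⟩
  rw [← pow_mul, mul_comm, ← e', pow_mul]
  exact hxn.1

/-- The index of commensurable subgroups of a nilpotent group is the product of its `T`-part and
its `S`-part, which are the indices of the two isolators. -/
theorem IsComplementaryPair.relIndex_eq_mul (h : IsComplementaryPair S T)
    {H₁ H₂ : Subgroup G} (h2 : H₂.relIndex H₁ ≠ 0) :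
    H₂.relIndex H₁ = (isolator S H₂).relIndex (isolator S H₁) *
      (isolator T H₂).relIndex (isolator T H₁) := by
  have e1 : (isolator S H₂).relIndex H₁ = (isolator S H₂).relIndex (isolator S H₁) := by
    rw [← h.relIndex_inf_isolator h2 (K := H₁) (by simp), h.isolator_inf_isolator]
  have e2 : (isolator T H₂).relIndex (isolator S H₂ ⊓ H₁) =
      (isolator T H₂).relIndex (isolator T H₁) := by
    rw [← h.symm.relIndex_inf_isolator h2 (K := H₂ ⊓ H₁) (by rwa [inf_relIndex_right]),
      isolator_inf, inf_left_comm, inf_comm (isolator T H₁), h.isolator_inf_isolator]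
  have e3 := relIndex_inf_mul_relIndex (isolator T H₂) (isolator S H₂) H₁
  rw [inf_comm (isolator T H₂), h.isolator_inf_isolator, e1, e2] at e3
  rw [← e3, mul_comm]

theorem IsComplementaryPair.commIndex_eq_mul (h : IsComplementaryPair S T)
    {H K : Subgroup G} (hc : commIndex H K ≠ 0) :
    commIndex H K = commIndex (isolator S H) (isolator S K) *
      commIndex (isolator T H) (isolator T K) := by
  have h' := mul_ne_zero_iff.1 hc
  rw [commIndex, commIndex, commIndex, h.relIndex_eq_mul h'.1, h.relIndex_eq_mul h'.2]
  ring

theorem IsComplementaryPair.commIndex_isolator_mem (h : IsComplementaryPair S T)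
    {H K : Subgroup G} (hc : commIndex H K ≠ 0) :
    commIndex (isolator S H) (isolator S K) ∈ T := by
  have h' := mul_ne_zero_iff.1 hc
  exact mul_mem (h.relIndex_isolator_mem h'.1) (h.relIndex_isolator_mem h'.2)

/-- The two isolator indices are the `T`-part and the `S`-part of the index. -/
theorem IsComplementaryPair.commIndex_isolator_eq (h : IsComplementaryPair S T)
    {H K : Subgroup G} {a b : ℕ} (ha : a ∈ T) (hb : b ∈ S) (hc : commIndex H K = a * b) :
    commIndex (isolator S H) (isolator S K) = a ∧ commIndex (isolator T H) (isolator T K) = b := by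
  have hc0 : commIndex H K ≠ 0 := by
    rw [hc]
    exact mul_ne_zero (fun h0 => h.zero_notMem_right (h0 ▸ ha))
      (fun h0 => h.zero_notMem_left (h0 ▸ hb))
  have hx := h.commIndex_isolator_mem hc0
  have hy := h.symm.commIndex_isolator_mem hc0
  have e := h.commIndex_eq_mul hc0
  rw [hc] at e
  exact ⟨Nat.dvd_antisymm
      ((h.coprime _ hb _ hx).symm.dvd_of_dvd_mul_right (e ▸ dvd_mul_right _ _))
      ((h.coprime _ hy _ ha).symm.dvd_of_dvd_mul_right (e ▸ dvd_mul_right _ _)),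
    Nat.dvd_antisymm
      ((h.coprime _ hy _ ha).dvd_of_dvd_mul_left (e ▸ dvd_mul_left _ _))
      ((h.coprime _ hb _ hx).dvd_of_dvd_mul_left (e ▸ dvd_mul_left _ _))⟩

/-- Subgroups whose index is a `T`-number have the same `T`-isolator: the index of the
isolators is the `S`-part, which is trivial. -/
theorem IsComplementaryPair.isolator_eq_of_commIndex_mem (h : IsComplementaryPair S T)
    {H K : Subgroup G} (hc : commIndex H K ∈ T) : isolator T K = isolator T H := by
  exact commIndex_eq_one_iff.1
    (h.commIndex_isolator_eq hc (one_mem S) (mul_one _).symm).2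

/-- The glued subgroup `isolator S H ⊓ isolator T K` has the same `S`-isolator as `H` (and, by
symmetry, the same `T`-isolator as `K`). -/
theorem IsComplementaryPair.isolator_glue (h : IsComplementaryPair S T)
    {H K : Subgroup G} (hK : K.relIndex H ≠ 0) :
    isolator S (isolator S H ⊓ isolator T K) = isolator S H := by
  rw [isolator_inf, isolator_isolator, inf_eq_left]
  rintro x ⟨m, hm, hxm⟩
  have hm0 : m ≠ 0 := fun h0 => h.zero_notMem_left (h0 ▸ hm)
  obtain ⟨n, hn, -, hxn⟩ := exists_pow_mem_of_relIndex_ne_zero hK hxm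
  obtain ⟨s, hs, t, ht, e⟩ := h.exists_eq_mul (m * n) (by positivity)
  refine ⟨s, hs, t, ht, ?_⟩
  rw [← pow_mul, ← e, pow_mul]
  exact hxn.1

theorem IsComplementaryPair.isolator_glue' (h : IsComplementaryPair S T)
    {H K : Subgroup G} (hH : H.relIndex K ≠ 0) :
    isolator T (isolator S H ⊓ isolator T K) = isolator T K := by
  rw [inf_comm]
  exact h.symm.isolator_glue hH

theorem IsComplementaryPair.commIndex_glue (h : IsComplementaryPair S T) {L H K : Subgroup G}
    (hH : Commensurable H L) (hK : Commensurable K L) :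
    commIndex L (isolator S H ⊓ isolator T K) =
      commIndex (isolator S L) (isolator S H) * commIndex (isolator T L) (isolator T K) := by
  have hHK : Commensurable H K := hH.trans hK.symm
  have h0 : commIndex L (isolator S H ⊓ isolator T K) ≠ 0 := by
    refine mul_ne_zero (relIndex_inf_ne_zero
      (ne_zero_of_dvd_ne_zero hH.1 (relIndex_dvd_of_le_left _ (le_isolator S H)))
      (ne_zero_of_dvd_ne_zero hK.1 (relIndex_dvd_of_le_left _ (le_isolator T K)))) ?_
    nth_rw 1 [← h.isolator_inf_isolator L]
    refine relIndex_inf_ne_zero ?_ ?_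
    · rw [h.relIndex_inf_isolator hH.2 hHK.2]
      exact h.relIndex_isolator_ne_zero hH.2
    · rw [inf_comm, h.symm.relIndex_inf_isolator hK.2 hHK.1]
      exact h.symm.relIndex_isolator_ne_zero hK.2
  rw [h.commIndex_eq_mul h0, h.isolator_glue hHK.2, h.isolator_glue' hHK.1]

/-- The subgroups of index `a * b` with respect to `L`, with `a ∈ T` and `b ∈ S`, correspond to the
pairs of a subgroup of index `a` and one of index `b`, by gluing the two members of a pair. -/
def IsComplementaryPair.commIndexEquiv (h : IsComplementaryPair S T) (L : Subgroup G) {a b : ℕ}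
    (ha : a ∈ T) (hb : b ∈ S) :
    {Δ : Subgroup G // commIndex L Δ = a * b} ≃
      {Δ : Subgroup G // commIndex L Δ = a} × {Δ : Subgroup G // commIndex L Δ = b} :=
  have ha0 : a ≠ 0 := fun h0 => h.zero_notMem_right (h0 ▸ ha)
  have hb0 : b ≠ 0 := fun h0 => h.zero_notMem_left (h0 ▸ hb)
  have hcomm : ∀ {Δ : Subgroup G} {n : ℕ}, n ≠ 0 → commIndex L Δ = n → Commensurable Δ L :=
    fun hn e => commIndex_ne_zero_iff.1 (e ▸ hn)
  { toFun := fun Δ => (⟨isolator S Δ.1 ⊓ isolator T L, by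
        rw [h.commIndex_glue (hcomm (mul_ne_zero ha0 hb0) Δ.2) (.refl L), commIndex_self, mul_one]
        exact (h.commIndex_isolator_eq ha hb Δ.2).1⟩,
      ⟨isolator S L ⊓ isolator T Δ.1, by
        rw [h.commIndex_glue (.refl L) (hcomm (mul_ne_zero ha0 hb0) Δ.2), commIndex_self, one_mul]
        exact (h.commIndex_isolator_eq ha hb Δ.2).2⟩)
    invFun := fun P => ⟨isolator S P.1.1 ⊓ isolator T P.2.1, by
      rw [h.commIndex_glue (hcomm ha0 P.1.2) (hcomm hb0 P.2.2),
        (h.commIndex_isolator_eq ha (one_mem S) (P.1.2.trans (mul_one a).symm)).1,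
        (h.commIndex_isolator_eq (one_mem T) hb (P.2.2.trans (one_mul b).symm)).2]⟩
    left_inv := fun Δ => by
      have hΔ := hcomm (mul_ne_zero ha0 hb0) Δ.2
      ext1
      dsimp only
      rw [h.isolator_glue hΔ.2, h.isolator_glue' hΔ.2, h.isolator_inf_isolator]
    right_inv := fun P => by
      have h1 := hcomm ha0 P.1.2
      have h2 := hcomm hb0 P.2.2
      have h12 := h1.trans h2.symm
      have e1 : isolator T P.1.1 = isolator T L :=
        h.isolator_eq_of_commIndex_mem (P.1.2.symm ▸ ha)
      have e2 : isolator S P.2.1 = isolator S L :=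
        h.symm.isolator_eq_of_commIndex_mem (P.2.2.symm ▸ hb)
      ext1
      · ext1
        dsimp only
        rw [h.isolator_glue h12.2, ← e1, h.isolator_inf_isolator]
      · ext1
        dsimp only
        rw [h.isolator_glue' h12.1, ← e2, h.isolator_inf_isolator] }

/-- In a nilpotent group the number of subgroups of commensurability index `n` is multiplicative
in `n`. -/
theorem card_commIndex_mul (L : Subgroup G) {a b : ℕ} (ha : a ≠ 0) (hb : b ≠ 0)
    (hab : a.Coprime b) :
    Nat.card {Δ : Subgroup G // commIndex L Δ = a * b} =
      Nat.card {Δ : Subgroup G // commIndex L Δ = a} *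
        Nat.card {Δ : Subgroup G // commIndex L Δ = b} := by
  rw [← Nat.card_prod]
  exact Nat.card_congr ((isComplementaryPair_coprime_powDvd a).commIndexEquiv L
    ⟨ha, 1, by simp⟩ ⟨hb, hab.symm⟩)

end Splitting

/-! ### Formal Euler products -/

/-- A multiplicative arithmetic function is the formal product of its restrictions to the powers
of the primes. -/
theorem isFormalPrimeProduct_of_isMultiplicative {f : Nat.Primes → ArithmeticFunction ℕ}
    {g : ArithmeticFunction ℕ} (hg : g.IsMultiplicative)
    (hf : ∀ (p : Nat.Primes) (k : ℕ), f p ((p : ℕ) ^ k) = g ((p : ℕ) ^ k))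
    (hf' : ∀ (p : Nat.Primes) (n : ℕ), (∀ k, n ≠ (p : ℕ) ^ k) → f p n = 0) :
    IsFormalPrimeProduct f g := by
  classical
  have key : ∀ S : Finset Nat.Primes, ∀ n : ℕ, n ≠ 0 → (∏ p ∈ S, f p) n =
      if ∀ p : Nat.Primes, (p : ℕ) ∣ n → p ∈ S then g n else 0 := by
    intro S
    induction S using Finset.induction_on with
    | empty =>
      intro n hn
      rw [Finset.prod_empty]
      by_cases h1 : n = 1
      · subst h1
        rw [if_pos, ArithmeticFunction.one_one, hg.map_one]
        intro p hp
        exact absurd (Nat.dvd_one.1 hp) p.2.ne_one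
      · rw [ArithmeticFunction.one_apply_ne h1, if_neg]
        intro h
        obtain ⟨q, hq, hqn⟩ := Nat.exists_prime_and_dvd h1
        exact absurd (h ⟨q, hq⟩ hqn) (Finset.notMem_empty _)
    | insert p S hpS ih =>
      intro n hn
      obtain ⟨k, m, hpm, e⟩ := Nat.exists_eq_pow_mul_and_not_dvd hn (p : ℕ) p.2.ne_one
      have hm : m ≠ 0 := by rintro rfl; exact hpm (dvd_zero _)
      rw [Finset.prod_insert hpS, ArithmeticFunction.mul_apply,
        Finset.sum_eq_single (((p : ℕ) ^ k, m) : ℕ × ℕ)]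
      · rw [hf, ih m hm]
        have hiff : (∀ q : Nat.Primes, (q : ℕ) ∣ m → q ∈ S) ↔
            ∀ q : Nat.Primes, (q : ℕ) ∣ n → q ∈ insert p S := by
          constructor
          · intro h q hq
            rw [e] at hq
            rcases (Nat.Prime.dvd_mul q.2).1 hq with h1 | h1
            · have := (Nat.prime_dvd_prime_iff_eq q.2 p.2).1 (q.2.dvd_of_dvd_pow h1)
              exact Finset.mem_insert.2 (Or.inl (Subtype.ext this))
            · exact Finset.mem_insert_of_mem (h q h1)
          · intro h q hq
            refine (Finset.mem_insert.1 (h q (e ▸ hq.mul_left _))).resolve_left ?_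
            rintro rfl
            exact hpm hq
        simp only [hiff]
        split_ifs
        · rw [e, hg.map_mul_of_coprime
            (Nat.Coprime.pow_left k ((Nat.Prime.coprime_iff_not_dvd p.2).2 hpm))]
        · rw [mul_zero]
      · rintro ⟨x, y⟩ hxy hne
        rw [Nat.mem_divisorsAntidiagonal] at hxy
        -- A nonzero term has `x` a power of `p` and `y` prime to `p`.
        by_cases hx : ∃ l, x = (p : ℕ) ^ l
        · obtain ⟨l, rfl⟩ := hx
          have hy0 : y ≠ 0 := by
            rintro rfl
            exact hn (hxy.1.symm.trans (mul_zero _))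
          rw [ih y hy0, if_neg, mul_zero]
          intro h
          have hpy : ¬ (p : ℕ) ∣ y := fun hd => hpS (h p hd)
          apply hne
          have h1 := hxy.1
          dsimp only at h1
          rw [e] at h1
          have hc : ∀ l {z : ℕ}, ¬ (p : ℕ) ∣ z → ((p : ℕ) ^ l).Coprime z := fun l z hz =>
            Nat.Coprime.pow_left l ((Nat.Prime.coprime_iff_not_dvd p.2).2 hz)
          have h2 : y = m := Nat.dvd_antisymm
            ((hc k hpy).symm.dvd_of_dvd_mul_left (h1 ▸ dvd_mul_left y _))
            ((hc l hpm).symm.dvd_of_dvd_mul_left (h1.symm ▸ dvd_mul_left m _))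
          subst h2
          rw [Nat.mul_right_cancel (Nat.pos_of_ne_zero hm) h1]
        · rw [hf' p x (fun k hk => hx ⟨k, hk⟩), zero_mul]
      · intro h
        exact absurd (Nat.mem_divisorsAntidiagonal.2 ⟨e.symm, hn⟩) h
  intro n
  rcases eq_or_ne n 0 with rfl | hn
  · simp
  have hfin : {p : Nat.Primes | (p : ℕ) ∣ n}.Finite :=
    Set.Finite.of_finite_image ((n.divisors.finite_toSet).subset (by
      rintro _ ⟨p, hp, rfl⟩
      exact Nat.mem_divisors.2 ⟨hp, hn⟩)) (f := fun p : Nat.Primes => (p : ℕ))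
      (fun p _ q _ h => Subtype.ext h)
  filter_upwards [Filter.eventually_ge_atTop hfin.toFinset] with S hS
  rw [key S n hn, if_pos]
  intro p hp
  exact hS (hfin.mem_toFinset.2 hp)

/-! ### Matrix coefficients of a coalgebra -/

section Coalgebra

open Coalgebra Module

variable {K C : Type*} [Field K] [AddCommGroup C] [Module K C] [Coalgebra K C]

/-- Contraction `x ↦ (id ⊗ φ)(x)` of the second tensor factor commutes with the comultiplication
of the first one. -/
theorem comul_rid_lTensor (φ : C →ₗ[K] K) (x : C ⊗[K] C) :
    comul (R := K) (TensorProduct.rid K C (φ.lTensor C x)) =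
      ((TensorProduct.rid K C).toLinearMap ∘ₗ φ.lTensor C).lTensor C
        (TensorProduct.assoc K C C C (comul.rTensor C x)) := by
  induction x with
  | zero => simp
  | add x y hx hy => simp only [map_add, hx, hy]
  | tmul a b =>
    simp only [LinearMap.lTensor_tmul, TensorProduct.rid_tmul, map_smul, LinearMap.rTensor_tmul]
    generalize comul (R := K) a = y
    induction y with
    | zero => simp
    | add x y hx hy => rw [smul_add, hx, hy, TensorProduct.add_tmul, map_add, map_add]
    | tmul a₁ a₂ => simp

/-- Every finite subset of a coalgebra over a field lies in a finite-dimensional subspace `V` with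
`Δ(V) ⊆ V ⊗ C`: the span of the left factors of the comultiplications, written in a basis. -/
theorem exists_finiteDimensional_comul_mem_range (s : Set C) (hs : s.Finite) :
    ∃ V : Submodule K C, FiniteDimensional K V ∧ s ⊆ V ∧
      ∀ v ∈ V, comul (R := K) v ∈ LinearMap.range (V.subtype.rTensor C) := by
  classical
  let E := Basis.ofVectorSpace K C
  let b : C → (Basis.ofVectorSpaceIndex K C →₀ C) :=
    fun c => TensorProduct.equivFinsuppOfBasisRight E (comul (R := K) c)
  have hb : ∀ c, comul (R := K) c = (b c).sum fun i m => m ⊗ₜ E i := fun c => by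
    rw [← TensorProduct.equivFinsuppOfBasisRight_symm_apply]
    exact ((TensorProduct.equivFinsuppOfBasisRight E).symm_apply_apply _).symm
  let V : Submodule K C := Submodule.span K (⋃ c ∈ s, Set.range (b c))
  have hbV : ∀ c ∈ s, ∀ i, b c i ∈ V := fun c hc i =>
    Submodule.subset_span (Set.mem_biUnion hc (Set.mem_range_self i))
  refine ⟨V, FiniteDimensional.span_of_finite K (hs.biUnion fun c _ => ?_), ?_, ?_⟩
  · exact Finsupp.finite_range (b c)
  · intro c hc
    have h1 := congrArg (TensorProduct.rid K C) (Coalgebra.lTensor_counit_comul (R := K) c)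
    rw [hb c, TensorProduct.rid_tmul, one_smul, Finsupp.sum, map_sum, map_sum] at h1
    rw [← h1]
    refine V.sum_mem fun i _ => ?_
    rw [LinearMap.lTensor_tmul, TensorProduct.rid_tmul]
    exact V.smul_mem _ (hbV c hc i)
  · suffices h : V ≤ (LinearMap.range (V.subtype.rTensor C)).comap (comul (R := K)) from h
    rw [Submodule.span_le]
    intro v hv
    obtain ⟨c, hc, i, rfl⟩ := Set.mem_iUnion₂.1 hv
    change comul (R := K) (b c i) ∈ LinearMap.range (V.subtype.rTensor C)
    change comul (R := K) (TensorProduct.equivFinsuppOfBasisRight E (comul (R := K) c) i) ∈ _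
    rw [TensorProduct.equivFinsuppOfBasisRight_apply, comul_rid_lTensor, coassoc_apply, hb c,
      Finsupp.sum, map_sum, map_sum]
    refine Submodule.sum_mem _ fun k _ => ?_
    rw [LinearMap.lTensor_tmul, LinearMap.lTensor_tmul]
    exact ⟨(⟨b c k, hbV c hc k⟩ : V) ⊗ₜ _, by rw [LinearMap.rTensor_tmul]; rfl⟩

/-- Every finite subset of a coalgebra over a field lies in the span of the coefficients of a
matrix that is multiplicative for the comultiplication, the matrix of the comodule `V` above. -/
theorem exists_matrix_comul_counit_span (s : Set C) (hs : s.Finite) :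
    ∃ (m : ℕ) (M : Matrix (Fin m) (Fin m) C),
      (∀ i j, comul (R := K) (M i j) = ∑ k, M i k ⊗ₜ[K] M k j) ∧
      (∀ i j, counit (R := K) (M i j) = if i = j then 1 else 0) ∧
      s ⊆ Submodule.span K (Set.range fun p : Fin m × Fin m => M p.1 p.2) := by
  classical
  obtain ⟨V, hfin, hsV, hV⟩ := exists_finiteDimensional_comul_mem_range (K := K) s hs
  let v := finBasis K V
  choose y hy using fun j => hV (v j) (v j).2
  let M : Matrix (Fin (finrank K V)) (Fin (finrank K V)) C :=
    fun i j => TensorProduct.equivFinsuppOfBasisLeft v (y j) i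
  have hcomul : ∀ j, comul (R := K) (v j : C) = ∑ i, (v i : C) ⊗ₜ[K] M i j := fun j => by
    have h1 : y j = ∑ i, v i ⊗ₜ[K] M i j := by
      have h2 := (TensorProduct.equivFinsuppOfBasisLeft v).symm_apply_apply (y j)
      rw [TensorProduct.equivFinsuppOfBasisLeft_symm_apply, Finsupp.sum_fintype _ _ (by simp)] at h2
      exact h2.symm
    rw [← hy j, h1, map_sum]
    rfl
  -- Functionals on `C` dual to the basis of `V`, to compare coefficients with.
  choose f hf using fun i => LinearMap.exists_extend (v.coord i)
  have hfv : ∀ i j, f i (v j) = if j = i then 1 else 0 := fun i j => by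
    have := LinearMap.congr_fun (hf i) (v j)
    rw [LinearMap.comp_apply, Submodule.subtype_apply] at this
    rw [this, Basis.coord_apply, Basis.repr_self, Finsupp.single_apply]
  refine ⟨_, M, fun i j => ?_, fun i j => ?_, fun c hc => ?_⟩
  · have h1 := coassoc_apply (R := K) (v j : C)
    rw [hcomul j, map_sum, map_sum, map_sum] at h1
    simp only [LinearMap.rTensor_tmul, LinearMap.lTensor_tmul, hcomul, TensorProduct.sum_tmul,
      map_sum, TensorProduct.assoc_tmul] at h1
    have h2 := congrArg (fun z => TensorProduct.lid K _ ((f i).rTensor (C ⊗[K] C) z)) h1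
    simp only [map_sum, LinearMap.rTensor_tmul, TensorProduct.lid_tmul, hfv, ite_smul, one_smul,
      zero_smul, Finset.sum_ite_eq', Finset.mem_univ, if_true] at h2
    exact h2.symm
  · have h1 := congrArg (fun z => f i (TensorProduct.rid K C z))
      (Coalgebra.lTensor_counit_comul (R := K) (v j : C))
    simp only [hcomul, map_sum, LinearMap.lTensor_tmul, TensorProduct.rid_tmul, map_smul, hfv,
      smul_eq_mul, mul_ite, mul_one, mul_zero, Finset.sum_ite_eq', Finset.mem_univ, if_true] at h1
    rw [h1]
    simp only [eq_comm]
  · have hv : ∀ j, (v j : C) ∈ Submodule.span K (Set.range fun p : _ × _ => M p.1 p.2) := by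
      intro j
      have h1 := congrArg (TensorProduct.lid K C)
        (Coalgebra.rTensor_counit_comul (R := K) (v j : C))
      rw [hcomul, TensorProduct.lid_tmul, one_smul, map_sum, map_sum] at h1
      rw [← h1]
      refine Submodule.sum_mem _ fun i _ => ?_
      rw [LinearMap.rTensor_tmul, TensorProduct.lid_tmul]
      exact Submodule.smul_mem _ _ (Submodule.subset_span ⟨(i, j), rfl⟩)
    have h1 := v.sum_repr ⟨c, hsV hc⟩
    have h2 : c = ∑ i, v.repr ⟨c, hsV hc⟩ i • (v i : C) := by
      have h3 := congrArg V.subtype h1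
      rw [map_sum] at h3
      exact h3.symm
    rw [h2]
    exact Submodule.sum_mem _ fun i _ => Submodule.smul_mem _ _ (hv i)

end Coalgebra

section MatrixRep

open Coalgebra Module

variable {K B : Type*} [Field K] [CommSemiring B] [HopfAlgebra K B]

theorem exists_isMatrixRep_span (s : Set B) (hs : s.Finite) :
    ∃ (m : ℕ) (M : Matrix (Fin m) (Fin m) B), IsMatrixRep K M ∧
      s ⊆ Submodule.span K (Set.range fun p : Fin m × Fin m => M p.1 p.2) := by
  let _ : AddCommGroup B := Module.addCommMonoidToAddCommGroup K
  obtain ⟨m, M, h1, h2, h3⟩ := exists_matrix_comul_counit_span (K := K) s hs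
  exact ⟨m, M, ⟨h1, h2⟩, h3⟩

/-- The matrix of the quotient representation by the line of `v`, where `v j = 1`, in the basis of
the images of the standard basis vectors other than the `j`-th one. -/
def quotientMatrixRep {m : ℕ} (M : Matrix (Fin (m + 1)) (Fin (m + 1)) B) (v : Fin (m + 1) → K)
    (j : Fin (m + 1)) : Matrix (Fin m) (Fin m) B :=
  fun i k => M (j.succAbove i) (j.succAbove k) + (-v (j.succAbove i)) • M j (j.succAbove k)

theorem sum_smul_eq_of_mulVec_eq {m : ℕ} {M : Matrix (Fin m) (Fin m) B} {v : Fin m → K}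
    (hv : M.mulVec (fun j => algebraMap K B (v j)) = fun i => algebraMap K B (v i)) (i : Fin m) :
    ∑ k, v k • M i k = v i • 1 := by
  have h := congrFun hv i
  rw [← Algebra.algebraMap_eq_smul_one, ← h, Matrix.mulVec, dotProduct]
  exact Finset.sum_congr rfl fun k _ => by rw [Algebra.smul_def, mul_comm]

/-- The row `i` of `M` minus `v i` times its row `j` annihilates the fixed vector `v`; as `v j = 1`,
this expresses its `j`-th entry by the others. -/
theorem row_eq_sum_of_mulVec_eq {m : ℕ} {M : Matrix (Fin (m + 1)) (Fin (m + 1)) B}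
    {v : Fin (m + 1) → K} {j : Fin (m + 1)} (hj : v j = 1)
    (hv : M.mulVec (fun j => algebraMap K B (v j)) = fun i => algebraMap K B (v i))
    (i : Fin (m + 1)) :
    M i j + (-v i) • M j j =
      ∑ l, (-v (j.succAbove l)) • (M i (j.succAbove l) + (-v i) • M j (j.succAbove l)) := by
  let _ : AddCommGroup B := Module.addCommMonoidToAddCommGroup K
  have h1 := sum_smul_eq_of_mulVec_eq hv i
  have h2 := sum_smul_eq_of_mulVec_eq hv j
  rw [Fin.sum_univ_succAbove _ j, hj, one_smul] at h1 h2
  rw [← eq_sub_iff_add_eq] at h1 h2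
  rw [h1, h2]
  simp only [smul_add, smul_sub, Finset.sum_add_distrib, Finset.smul_sum, neg_smul,
    Finset.sum_neg_distrib, one_smul, smul_neg]
  simp only [smul_comm (v i)]
  abel

theorem isMatrixRep_quotientMatrixRep {m : ℕ} {M : Matrix (Fin (m + 1)) (Fin (m + 1)) B}
    (hM : IsMatrixRep K M) {v : Fin (m + 1) → K} {j : Fin (m + 1)} (hj : v j = 1)
    (hv : M.mulVec (fun j => algebraMap K B (v j)) = fun i => algebraMap K B (v i)) :
    IsMatrixRep K (quotientMatrixRep M v j) := by
  constructor
  · intro i k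
    have hrow := row_eq_sum_of_mulVec_eq hj hv (j.succAbove i)
    simp only [quotientMatrixRep]
    simp only [map_add, map_smul, hM.1, Finset.smul_sum, TensorProduct.smul_tmul',
      ← Finset.sum_add_distrib, ← TensorProduct.add_tmul]
    rw [Fin.sum_univ_succAbove _ j, hrow]
    simp only [TensorProduct.tmul_add, Finset.sum_add_distrib, TensorProduct.sum_tmul,
      TensorProduct.tmul_smul, TensorProduct.smul_tmul']
    rw [add_comm]
  · intro i k
    simp only [quotientMatrixRep, map_add, map_smul, hM.2]
    rw [if_neg (Fin.succAbove_ne j k).symm, smul_zero, add_zero]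
    simp only [(Fin.succAbove_right_injective (p := j)).eq_iff]

variable {R : Type*} [CommRing R] [Algebra K R]

/-- The projection `w ↦ (wᵢ - vᵢ wⱼ)` to the quotient by `v` intertwines `M` and the quotient
representation. -/
theorem quotientMatrixRep_map_mulVec {m : ℕ} {M : Matrix (Fin (m + 1)) (Fin (m + 1)) B}
    {v : Fin (m + 1) → K} {j : Fin (m + 1)} (hj : v j = 1)
    (hv : M.mulVec (fun j => algebraMap K B (v j)) = fun i => algebraMap K B (v i))
    (φ : B →ₐ[K] R) (w : Fin (m + 1) → R) (i : Fin m) :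
    ((quotientMatrixRep M v j).map φ).mulVec
        (fun i => w (j.succAbove i) - algebraMap K R (v (j.succAbove i)) * w j) i =
      (M.map φ).mulVec w (j.succAbove i) -
        algebraMap K R (v (j.succAbove i)) * (M.map φ).mulVec w j := by
  have hrow := congrArg φ (row_eq_sum_of_mulVec_eq hj hv (j.succAbove i))
  simp only [map_add, map_sum, map_smul] at hrow
  simp only [Algebra.smul_def, map_neg] at hrow
  simp only [Matrix.mulVec, dotProduct, Matrix.map_apply, quotientMatrixRep, map_add, map_smul]
  simp only [Algebra.smul_def, map_neg]
  rw [Fin.sum_univ_succAbove (fun l => φ (M (j.succAbove i) l) * w l) j,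
    Fin.sum_univ_succAbove (fun l => φ (M j l) * w l) j]
  have e : φ (M (j.succAbove i) j) = algebraMap K R (v (j.succAbove i)) * φ (M j j) +
      ∑ l, -algebraMap K R (v (j.succAbove l)) * (φ (M (j.succAbove i) (j.succAbove l)) +
        -algebraMap K R (v (j.succAbove i)) * φ (M j (j.succAbove l))) := by
    rw [← hrow]
    ring
  rw [e, add_mul, Finset.sum_mul, mul_add (algebraMap K R _), Finset.mul_sum,
    mul_assoc (algebraMap K R _), add_assoc, add_sub_add_left_eq_sub, ← Finset.sum_add_distrib,
    ← Finset.sum_sub_distrib]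
  exact Finset.sum_congr rfl fun l _ => by ring

/-- All products of `m` factors `M(x) - 1` vanish in a representation of dimension `m` of a
unipotent group, by induction on `m` through the quotient by a fixed line. -/
theorem IsUnipotentGroup.prod_map_sub_one_mulVec (hB : IsUnipotentGroup K B) (m : ℕ)
    (M : Matrix (Fin m) (Fin m) B) (hM : IsMatrixRep K M) (l : List (B →ₐ[K] R))
    (hl : l.length = m) (w : Fin m → R) :
    (l.map fun φ : B →ₐ[K] R => M.map φ - 1).prod.mulVec w = 0 := by
  induction m generalizing l with
  | zero => exact Subsingleton.elim _ _
  | succ m ih =>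
    obtain ⟨v', hv0, hv'⟩ := hB (m + 1) M (Nat.succ_pos m) hM
    obtain ⟨j, hj'⟩ := Function.ne_iff.1 hv0
    obtain ⟨v, hj, hv⟩ : ∃ v : Fin (m + 1) → K, v j = 1 ∧
        M.mulVec (fun j => algebraMap K B (v j)) = fun i => algebraMap K B (v i) := by
      refine ⟨(v' j)⁻¹ • v', inv_mul_cancel₀ hj', ?_⟩
      have h1 := congrArg (fun z => algebraMap K B (v' j)⁻¹ • z) hv'
      simp only [← Matrix.mulVec_smul] at h1
      convert h1 using 1
      · congr 1
        ext i
        simp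
      · ext i
        simp
    -- The intertwining property, for a product of factors `M(x) - 1`.
    have key : ∀ (l : List (B →ₐ[K] R)) (w : Fin (m + 1) → R),
        (fun i => (l.map fun φ : B →ₐ[K] R => M.map φ - 1).prod.mulVec w (j.succAbove i) -
          algebraMap K R (v (j.succAbove i)) *
            (l.map fun φ : B →ₐ[K] R => M.map φ - 1).prod.mulVec w j) =
        (l.map fun φ : B →ₐ[K] R => (quotientMatrixRep M v j).map φ - 1).prod.mulVec
          (fun i => w (j.succAbove i) - algebraMap K R (v (j.succAbove i)) * w j) := by
      intro l w
      induction l with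
      | nil => simp
      | cons φ l ihl =>
        simp only [List.map_cons, List.prod_cons, ← Matrix.mulVec_mulVec]
        rw [← ihl, Matrix.sub_mulVec, Matrix.sub_mulVec, Matrix.one_mulVec, Matrix.one_mulVec]
        ext i
        rw [Pi.sub_apply, Pi.sub_apply, Pi.sub_apply, quotientMatrixRep_map_mulVec hj hv]
        ring
    obtain ⟨φ, l, rfl⟩ := List.exists_cons_of_length_eq_add_one hl
    rw [List.map_cons, List.prod_cons, ← Matrix.mulVec_mulVec]
    set u := (l.map fun φ : B →ₐ[K] R => M.map φ - 1).prod.mulVec w with hu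
    have h0 := key l w
    rw [ih _ (isMatrixRep_quotientMatrixRep hM hj hv) l (by simpa using hl)] at h0
    -- So `u` is a multiple of the fixed vector `v`.
    have huv : ∀ i, u i = u j * algebraMap K R (v i) := by
      intro i
      rcases Fin.eq_self_or_eq_succAbove j i with rfl | ⟨i, rfl⟩
      · rw [hj, map_one, mul_one]
      · rw [mul_comm]
        exact sub_eq_zero.1 (congrFun h0 i)
    ext i
    rw [Matrix.sub_mulVec, Matrix.one_mulVec, Pi.sub_apply, Pi.zero_apply, sub_eq_zero]
    have h1 := congrArg φ (sum_smul_eq_of_mulVec_eq hv i)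
    simp only [map_sum, map_smul, map_one] at h1
    simp only [Algebra.smul_def, mul_one] at h1
    rw [huv i, ← h1, Matrix.mulVec, dotProduct, Finset.mul_sum]
    refine Finset.sum_congr rfl fun k _ => ?_
    rw [Matrix.map_apply, huv k]
    ring

theorem IsUnipotentGroup.prod_map_sub_one_eq_zero (hB : IsUnipotentGroup K B) {m : ℕ}
    {M : Matrix (Fin m) (Fin m) B} (hM : IsMatrixRep K M) {l : List (B →ₐ[K] R)}
    (hl : l.length = m) : (l.map fun φ : B →ₐ[K] R => M.map φ - 1).prod = 0 :=
  Matrix.mulVec_injective (funext fun w => by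
    rw [hB.prod_map_sub_one_mulVec m M hM l hl w, Matrix.zero_mulVec])

end MatrixRep

/-! ### Nilpotency of groups with a unipotent faithful representation -/

section Nilpotent

variable {G E : Type*} [Group G] [Ring E]

/-- The additive span of the elements `ρ x - 1`: the image of the augmentation ideal. -/
def augmentationSpan (ρ : G →* E) : Submodule ℤ E :=
  Submodule.span ℤ (Set.range fun x => ρ x - 1)

theorem augmentationSpan_mul_self_le (ρ : G →* E) :
    augmentationSpan ρ * augmentationSpan ρ ≤ augmentationSpan ρ := by
  rw [augmentationSpan, Submodule.span_mul_span, Submodule.span_le]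
  rintro _ ⟨_, ⟨x, rfl⟩, _, ⟨y, rfl⟩, rfl⟩
  have h : (ρ x - 1) * (ρ y - 1) = (ρ (x * y) - 1) - (ρ x - 1) - (ρ y - 1) := by
    rw [map_mul]
    noncomm_ring
  change (ρ x - 1) * (ρ y - 1) ∈ _
  rw [h]
  have hmem : ∀ z, ρ z - 1 ∈ Submodule.span ℤ (Set.range fun x => ρ x - 1) := fun z =>
    Submodule.subset_span ⟨z, rfl⟩
  exact Submodule.sub_mem _ (Submodule.sub_mem _ (hmem _) (hmem _)) (hmem _)

theorem mul_map_mem_augmentationSpan_pow (ρ : G →* E) {n : ℕ} {e : E}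
    (he : e ∈ augmentationSpan ρ ^ (n + 1)) (y : G) : e * ρ y ∈ augmentationSpan ρ ^ (n + 1) := by
  have h1 : e * (ρ y - 1) ∈ augmentationSpan ρ ^ (n + 1) := by
    have h2 : e * (ρ y - 1) ∈ augmentationSpan ρ ^ (n + 1) * augmentationSpan ρ :=
      Submodule.mul_mem_mul he (Submodule.subset_span ⟨y, rfl⟩)
    rw [pow_succ, mul_assoc] at h2
    rw [pow_succ]
    exact mul_le_mul_right (augmentationSpan_mul_self_le ρ) _ h2
  have h3 : e * ρ y = e * (ρ y - 1) + e := by noncomm_ring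
  rw [h3]
  exact Submodule.add_mem _ h1 he

/-- The elements `x` with `ρ x - 1` in the `n + 1`-st power of the augmentation span. -/
def augmentationSubgroup (ρ : G →* E) (n : ℕ) : Subgroup G where
  carrier := {x | ρ x - 1 ∈ augmentationSpan ρ ^ (n + 1)}
  one_mem' := by simp
  mul_mem' := by
    intro x y hx hy
    have h : ρ (x * y) - 1 = (ρ x - 1) * ρ y + (ρ y - 1) := by
      rw [map_mul]
      noncomm_ring
    change ρ (x * y) - 1 ∈ augmentationSpan ρ ^ (n + 1)
    rw [h]
    exact Submodule.add_mem _ (mul_map_mem_augmentationSpan_pow ρ hx y) hy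
  inv_mem' := by
    intro x hx
    have h : ρ x⁻¹ - 1 = -((ρ x - 1) * ρ x⁻¹) := by
      rw [sub_mul, ← map_mul, mul_inv_cancel, map_one, one_mul, neg_sub]
    change ρ x⁻¹ - 1 ∈ augmentationSpan ρ ^ (n + 1)
    rw [h]
    exact Submodule.neg_mem _ (mul_map_mem_augmentationSpan_pow ρ hx _)

theorem isDescendingCentralSeries_augmentationSubgroup (ρ : G →* E) :
    Subgroup.IsDescendingCentralSeries (augmentationSubgroup ρ) := by
  refine ⟨?_, fun x n hx y => ?_⟩
  · refine eq_top_iff.2 fun x _ => ?_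
    change ρ x - 1 ∈ augmentationSpan ρ ^ (0 + 1)
    rw [zero_add, pow_one]
    exact Submodule.subset_span ⟨x, rfl⟩
  · have hy : ρ y - 1 ∈ augmentationSpan ρ := Submodule.subset_span ⟨y, rfl⟩
    have h1 : (ρ x - 1) * (ρ y - 1) - (ρ y - 1) * (ρ x - 1) ∈
        augmentationSpan ρ ^ (n + 1 + 1) := by
      refine Submodule.sub_mem _ ?_ ?_
      · rw [pow_succ]
        exact Submodule.mul_mem_mul hx hy
      · rw [pow_succ']
        exact Submodule.mul_mem_mul hy hx
    have h2 : ρ (x * y * x⁻¹ * y⁻¹) - 1 =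
        ((ρ x - 1) * (ρ y - 1) - (ρ y - 1) * (ρ x - 1)) * ρ (x⁻¹ * y⁻¹) := by
      have h3 : (ρ x - 1) * (ρ y - 1) - (ρ y - 1) * (ρ x - 1) = ρ (x * y) - ρ (y * x) := by
        rw [map_mul, map_mul]
        noncomm_ring
      rw [h3, sub_mul, ← map_mul, ← map_mul, ← map_one ρ]
      congr 2 <;> group
    change ρ (x * y * x⁻¹ * y⁻¹) - 1 ∈ augmentationSpan ρ ^ (n + 1 + 1)
    rw [h2]
    exact mul_map_mem_augmentationSpan_pow ρ h1 _

/-- If all products of `m` factors `ρ x - 1` vanish, for a faithful representation `ρ`, then the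
group is nilpotent. -/
theorem isNilpotent_of_prod_sub_one_eq_zero (ρ : G →* E) (hρ : Function.Injective ρ) (m : ℕ)
    (h : ∀ l : List G, l.length = m → (l.map fun x => ρ x - 1).prod = 0) :
    Group.IsNilpotent G := by
  have hm : augmentationSpan ρ ^ m = ⊥ := by
    rw [augmentationSpan, Submodule.span_pow, Submodule.span_eq_bot]
    intro e he
    obtain ⟨f, rfl⟩ := Set.mem_pow.1 he
    choose g hg using fun i => (f i).2
    rw [← h (List.ofFn g) (List.length_ofFn), List.map_ofFn]
    congr 2
    ext i
    exact (hg i).symm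
  refine (Subgroup.nilpotent_iff_finite_descending_central_series G).2
    ⟨m, augmentationSubgroup ρ, isDescendingCentralSeries_augmentationSubgroup ρ, ?_⟩
  refine eq_bot_iff.2 fun x hx => ?_
  have hx' : ρ x - 1 ∈ augmentationSpan ρ ^ (m + 1) := hx
  rw [pow_succ, hm, Submodule.bot_mul, Submodule.mem_bot, sub_eq_zero, ← map_one ρ] at hx'
  exact Subgroup.mem_bot.2 (hρ hx')

end Nilpotent

/-! ### Matrix representations of the groups of points -/

section Points

variable {A : Type*} [CommSemiring A] [HopfAlgebra ℤ A] {R : Type*} [CommRing R] [Algebra ℚ R]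

/-- The extension of an `R`-point of `Spec A` to the coordinate ring of the generic fibre, for a
`ℚ`-algebra `R`. -/
noncomputable def genericExtension (φ : A →ₐ[ℤ] R) : ℚ ⊗[ℤ] A →ₐ[ℚ] R :=
  Algebra.TensorProduct.lift (Algebra.ofId ℚ R) φ fun _ _ => Commute.all _ _

@[simp]
theorem genericExtension_tmul (φ : A →ₐ[ℤ] R) (q : ℚ) (a : A) :
    genericExtension φ (q ⊗ₜ a) = algebraMap ℚ R q * φ a := rfl

theorem genericExtension_comp {R' : Type*} [CommRing R'] [Algebra ℚ R'] (f : R →ₐ[ℚ] R')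
    (φ : A →ₐ[ℤ] R) :
    genericExtension ((f.restrictScalars ℤ).comp φ) = f.comp (genericExtension φ) := by
  refine Algebra.TensorProduct.ext (by ext) ?_
  ext a
  simp

theorem genericExtension_one :
    genericExtension (1 : GPoints A R).ofConv =
      (Algebra.ofId ℚ R).comp (Bialgebra.counitAlgHom ℚ (ℚ ⊗[ℤ] A)) := by
  refine Algebra.TensorProduct.ext (by ext) ?_
  ext a
  simp [AlgHom.convOne_def]

theorem genericExtension_mul (x y : GPoints A R) :
    genericExtension (x * y).ofConv =
      (Algebra.TensorProduct.lift (genericExtension x.ofConv) (genericExtension y.ofConv)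
        fun _ _ => Commute.all _ _).comp (Bialgebra.comulAlgHom ℚ (ℚ ⊗[ℤ] A)) := by
  refine Algebra.TensorProduct.ext (by ext) ?_
  ext a
  change genericExtension (x * y).ofConv (1 ⊗ₜ a) = Algebra.TensorProduct.lift _ _
    (fun _ _ => Commute.all _ _) (Coalgebra.comul (R := ℚ) ((1 : ℚ) ⊗ₜ[ℤ] a))
  rw [genericExtension_tmul, map_one, one_mul, TensorProduct.comul_tmul]
  change (x * y) a = _
  rw [AlgHom.convMul_apply]
  generalize Coalgebra.comul (R := ℤ) a = z
  induction z with
  | zero => simp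
  | add z w hz hw => simp only [map_add, TensorProduct.tmul_add, hz, hw]
  | tmul b c => simp

variable (R) in
/-- The action of `G(R)` in a matrix representation of the generic fibre. -/
noncomputable def pointRep {m : ℕ} {M : Matrix (Fin m) (Fin m) (ℚ ⊗[ℤ] A)}
    (hM : IsMatrixRep ℚ M) : GPoints A R →* Matrix (Fin m) (Fin m) R where
  toFun x := M.map (genericExtension x.ofConv)
  map_one' := by
    ext i j
    rw [Matrix.map_apply, genericExtension_one, Matrix.one_apply]
    change algebraMap ℚ R (Coalgebra.counit (R := ℚ) (M i j)) = _
    rw [hM.2]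
    split_ifs <;> simp
  map_mul' x y := by
    ext i j
    rw [Matrix.map_apply, genericExtension_mul, Matrix.mul_apply]
    change Algebra.TensorProduct.lift _ _ (fun _ _ => Commute.all _ _)
      (Coalgebra.comul (R := ℚ) (M i j)) = _
    rw [hM.1, map_sum]
    rfl

theorem pointRep_apply {m : ℕ} {M : Matrix (Fin m) (Fin m) (ℚ ⊗[ℤ] A)} (hM : IsMatrixRep ℚ M)
    (x : GPoints A R) (i j : Fin m) :
    pointRep R hM x i j = genericExtension x.ofConv (M i j) := rfl

/-- The coefficients of `M` span a subspace that contains generators of the coordinate ring. -/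
def IsGeneratingRep {m : ℕ} (M : Matrix (Fin m) (Fin m) (ℚ ⊗[ℤ] A)) (s : Finset A) : Prop :=
  Algebra.adjoin ℤ (s : Set A) = ⊤ ∧ ∀ a ∈ s, (1 : ℚ) ⊗ₜ[ℤ] a ∈
    Submodule.span ℚ (Set.range fun p : Fin m × Fin m => M p.1 p.2)

theorem exists_isGeneratingRep [hA : Algebra.FiniteType ℤ A] :
    ∃ (m : ℕ) (M : Matrix (Fin m) (Fin m) (ℚ ⊗[ℤ] A)) (s : Finset A),
      IsMatrixRep ℚ M ∧ IsGeneratingRep M s := by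
  obtain ⟨s, hs⟩ := hA.out
  obtain ⟨m, M, hM, h⟩ := exists_isMatrixRep_span (K := ℚ)
    ((fun a : A => (1 : ℚ) ⊗ₜ[ℤ] a) '' (s : Set A)) (s.finite_toSet.image _)
  exact ⟨m, M, s, hM, hs, fun a ha => h ⟨a, ha, rfl⟩⟩

/-- The values of a point at the generators are rational linear combinations of the entries of its
matrix, with coefficients that do not depend on the point. -/
theorem IsGeneratingRep.exists_apply_eq_sum {m : ℕ} {M : Matrix (Fin m) (Fin m) (ℚ ⊗[ℤ] A)}
    {s : Finset A} (h : IsGeneratingRep M s) (hM : IsMatrixRep ℚ M) {a : A} (ha : a ∈ s) :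
    ∃ c : Fin m × Fin m → ℚ, ∀ x : GPoints A R,
      x.ofConv a = ∑ p, algebraMap ℚ R (c p) * pointRep R hM x p.1 p.2 := by
  obtain ⟨c, hc⟩ := (Submodule.mem_span_range_iff_exists_fun ℚ).1 (h.2 a ha)
  refine ⟨c, fun x => ?_⟩
  have h1 := congrArg (genericExtension x.ofConv) hc
  rw [genericExtension_tmul, map_one, one_mul, map_sum] at h1
  rw [← h1]
  exact Finset.sum_congr rfl fun p _ => by rw [map_smul, Algebra.smul_def, pointRep_apply]

theorem IsGeneratingRep.pointRep_injective {m : ℕ} {M : Matrix (Fin m) (Fin m) (ℚ ⊗[ℤ] A)}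
    {s : Finset A} (h : IsGeneratingRep M s) (hM : IsMatrixRep ℚ M) :
    Function.Injective (pointRep R hM) := by
  intro x y hxy
  refine WithConv.ofConv_injective (AlgHom.ext_of_adjoin_eq_top h.1 fun a ha => ?_)
  obtain ⟨c, hc⟩ := h.exists_apply_eq_sum (R := R) hM ha
  rw [hc x, hc y, hxy]

theorem IsUnipotentGroup.prod_pointRep_sub_one_eq_zero
    (hB : IsUnipotentGroup ℚ (ℚ ⊗[ℤ] A)) {m : ℕ} {M : Matrix (Fin m) (Fin m) (ℚ ⊗[ℤ] A)}
    (hM : IsMatrixRep ℚ M) {l : List (GPoints A R)} (hl : l.length = m) :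
    (l.map fun x => pointRep R hM x - 1).prod = 0 := by
  have h := hB.prod_map_sub_one_eq_zero hM (l := l.map fun x => genericExtension x.ofConv)
    (by rwa [List.length_map])
  rwa [List.map_map] at h

theorem IsUnipotentGroup.pointRep_sub_one_pow_eq_zero
    (hB : IsUnipotentGroup ℚ (ℚ ⊗[ℤ] A)) {m : ℕ} {M : Matrix (Fin m) (Fin m) (ℚ ⊗[ℤ] A)}
    (hM : IsMatrixRep ℚ M) (x : GPoints A R) : (pointRep R hM x - 1) ^ m = 0 := by
  have h := hB.prod_pointRep_sub_one_eq_zero hM (l := List.replicate m x) (List.length_replicate)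
  rwa [List.map_replicate, List.prod_replicate] at h

variable (R) in
theorem IsUnipotentZGroup.isNilpotent (hG : IsUnipotentZGroup A) :
    Group.IsNilpotent (GPoints A R) := by
  have := hG.1
  obtain ⟨m, M, s, hM, hs⟩ := exists_isGeneratingRep (A := A)
  exact isNilpotent_of_prod_sub_one_eq_zero (pointRep R hM) (hs.pointRep_injective hM) m
    fun l hl => hG.2.prod_pointRep_sub_one_eq_zero hM hl

end Points

/-! ### One-parameter subgroups and roots -/

section UnipotentPow

open Polynomial

theorem Polynomial.eq_of_eval_natCast_eq {p q : ℝ[X]}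
    (h : ∀ t : ℕ, p.eval (t : ℝ) = q.eval (t : ℝ)) : p = q :=
  eq_of_infinite_eval_eq p q (Set.infinite_of_injective_forall_mem Nat.cast_injective h)

/-- The polynomial `binom(X, k)`. -/
noncomputable def binomPoly (k : ℕ) : ℚ[X] := C ((k.factorial : ℚ)⁻¹) * descPochhammer ℚ k

theorem binomPoly_eval_natCast (k t : ℕ) : (binomPoly k).eval (t : ℚ) = t.choose k := by
  rw [binomPoly, eval_mul, eval_C, descPochhammer_eval_eq_descFactorial,
    Nat.descFactorial_eq_factorial_mul_choose, Nat.cast_mul, inv_mul_cancel_left₀]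
  exact_mod_cast k.factorial_ne_zero

theorem binomPoly_zero : binomPoly 0 = 1 := by simp [binomPoly]

theorem binomPoly_map_eval (k : ℕ) (q : ℚ) :
    ((binomPoly k).map (algebraMap ℚ ℝ)).eval (q : ℝ) = ((binomPoly k).eval q : ℚ) := by
  rw [← eq_ratCast (algebraMap ℚ ℝ) q, eval_map, eval₂_at_apply, eq_ratCast]

variable {m : ℕ}

/-- The matrix over `ℝ[X]` whose value at `t` is the power `u ^ t = ∑ binom(t, k) (u - 1) ^ k` of a
unipotent matrix `u` of size `m`; the terms with `k > m` vanish. -/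
noncomputable def unipotentPowPoly (u : Matrix (Fin m) (Fin m) ℝ) : Matrix (Fin m) (Fin m) ℝ[X] :=
  fun i j => ∑ k ∈ Finset.range (m + 1),
    (binomPoly k).map (algebraMap ℚ ℝ) * C (((u - 1) ^ k) i j)

/-- The real power `u ^ t` of a unipotent matrix `u`. -/
noncomputable def unipotentPow (u : Matrix (Fin m) (Fin m) ℝ) (t : ℝ) :
    Matrix (Fin m) (Fin m) ℝ :=
  (evalRingHom t).mapMatrix (unipotentPowPoly u)

theorem unipotentPow_apply (u : Matrix (Fin m) (Fin m) ℝ) (t : ℝ) (i j : Fin m) :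
    unipotentPow u t i j = (unipotentPowPoly u i j).eval t := rfl

theorem unipotentPow_eq_sum (u : Matrix (Fin m) (Fin m) ℝ) (q : ℚ) :
    unipotentPow u q = ∑ k ∈ Finset.range (m + 1),
      (((binomPoly k).eval q : ℚ) : ℝ) • (u - 1) ^ k := by
  ext i j
  rw [unipotentPow_apply, unipotentPowPoly, eval_finsetSum, Matrix.sum_apply]
  refine Finset.sum_congr rfl fun k _ => ?_
  rw [eval_mul, eval_C, binomPoly_map_eval, Matrix.smul_apply, smul_eq_mul]

theorem unipotentPow_natCast {u : Matrix (Fin m) (Fin m) ℝ} (hu : (u - 1) ^ m = 0) (t : ℕ) :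
    unipotentPow u (t : ℝ) = u ^ t := by
  have h0 : ∀ k, m ≤ k → (u - 1) ^ k = 0 := fun k hk => pow_eq_zero_of_le hk hu
  have h1 : u ^ t = ∑ k ∈ Finset.range (t + 1), (t.choose k : ℝ) • (u - 1) ^ k := by
    have h2 := (Commute.one_right (u - 1)).add_pow t
    rw [sub_add_cancel] at h2
    rw [h2]
    refine Finset.sum_congr rfl fun k _ => ?_
    rw [one_pow, mul_one, ← nsmul_eq_mul', Nat.cast_smul_eq_nsmul]
  have h2 : unipotentPow u (t : ℝ) = unipotentPow u ((t : ℚ) : ℝ) := by rw [Rat.cast_natCast]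
  rw [h2, unipotentPow_eq_sum, h1]
  simp only [binomPoly_eval_natCast, Rat.cast_natCast]
  -- Both sums agree with the one over a common larger range.
  rw [Finset.sum_subset (Finset.range_mono (Nat.succ_le_succ (le_max_left m t))) fun k _ hk => ?_,
    Finset.sum_subset (Finset.range_mono (Nat.succ_le_succ (le_max_right m t))) fun k _ hk => ?_]
  · rw [Nat.choose_eq_zero_of_lt (by simpa using hk), Nat.cast_zero, zero_smul]
  · rw [h0 k (by simp at hk; omega), smul_zero]

theorem unipotentPow_one {u : Matrix (Fin m) (Fin m) ℝ} (hu : (u - 1) ^ m = 0) :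
    unipotentPow u 1 = u := by
  have h := unipotentPow_natCast hu 1
  rwa [Nat.cast_one, pow_one] at h

theorem unipotentPow_pow {u : Matrix (Fin m) (Fin m) ℝ} (hu : (u - 1) ^ m = 0) (r : ℕ) (t : ℝ) :
    unipotentPow u t ^ r = unipotentPow u (r * t) := by
  have h : unipotentPowPoly u ^ r =
      (unipotentPowPoly u).map fun p => p.comp (C (r : ℝ) * X) := by
    ext1 i j
    refine eq_of_eval_natCast_eq fun t => ?_
    rw [Matrix.map_apply, eval_comp, eval_mul, eval_C, eval_X, ← unipotentPow_apply,
      ← Nat.cast_mul, unipotentPow_natCast hu, mul_comm, pow_mul, ← unipotentPow_natCast hu t,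
      unipotentPow, ← map_pow]
    rfl
  rw [unipotentPow, ← map_pow, h]
  ext i j
  change ((unipotentPowPoly u i j).comp _).eval t = (unipotentPowPoly u i j).eval (r * t)
  rw [eval_comp, eval_mul, eval_C, eval_X]

theorem unipotentPow_of_pow {u : Matrix (Fin m) (Fin m) ℝ} (hu : (u - 1) ^ m = 0) (r : ℕ)
    (hur : (u ^ r - 1) ^ m = 0) (t : ℝ) : unipotentPow (u ^ r) t = unipotentPow u (r * t) := by
  ext i j
  rw [unipotentPow_apply, unipotentPow_apply]
  have h : unipotentPowPoly (u ^ r) i j = (unipotentPowPoly u i j).comp (C (r : ℝ) * X) := by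
    refine eq_of_eval_natCast_eq fun t => ?_
    rw [eval_comp, eval_mul, eval_C, eval_X, ← unipotentPow_apply, ← unipotentPow_apply,
      ← Nat.cast_mul, unipotentPow_natCast hu, unipotentPow_natCast hur, pow_mul]
  rw [h, eval_comp, eval_mul, eval_C, eval_X]

/-- `r`-th roots of unipotent matrices are unique. -/
theorem unipotentPow_pow_inv {u : Matrix (Fin m) (Fin m) ℝ} (hu : (u - 1) ^ m = 0) {r : ℕ}
    (hr : r ≠ 0) (hur : (u ^ r - 1) ^ m = 0) : unipotentPow (u ^ r) ((r : ℚ)⁻¹ : ℚ) = u := by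
  rw [unipotentPow_of_pow hu r hur, Rat.cast_inv, Rat.cast_natCast,
    mul_inv_cancel₀ (Nat.cast_ne_zero.2 hr), unipotentPow_one hu]

variable {A : Type*} [CommSemiring A] [HopfAlgebra ℤ A]
  {M : Matrix (Fin m) (Fin m) (ℚ ⊗[ℤ] A)} {s : Finset A}

/-- The powers of a real point `x` of a unipotent group interpolate to a one-parameter subgroup,
that is to a point over `ℝ[X]`. -/
theorem exists_polynomial_interpolation (hG : IsUnipotentZGroup A) (hM : IsMatrixRep ℚ M)
    (hs : IsGeneratingRep M s) (x : GPoints A ℝ) :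
    ∃ P : A →ₐ[ℤ] ℝ[X], ∀ (t : ℕ) (a : A), (P a).eval (t : ℝ) = (x ^ t).ofConv a := by
  have h : ∀ a : A, ∃ p : ℝ[X], ∀ t : ℕ, p.eval (t : ℝ) = (x ^ t).ofConv a := by
    intro a
    have ha : a ∈ Algebra.adjoin ℤ (s : Set A) := hs.1 ▸ Algebra.mem_top
    induction ha using Algebra.adjoin_induction with
    | mem a ha =>
      obtain ⟨c, hc⟩ := hs.exists_apply_eq_sum (R := ℝ) hM ha
      refine ⟨∑ p, C (algebraMap ℚ ℝ (c p)) * unipotentPowPoly (pointRep ℝ hM x) p.1 p.2,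
        fun t => ?_⟩
      rw [hc, eval_finsetSum]
      refine Finset.sum_congr rfl fun p _ => ?_
      rw [eval_mul, eval_C, ← unipotentPow_apply,
        unipotentPow_natCast (hG.2.pointRep_sub_one_pow_eq_zero hM x), map_pow]
    | algebraMap n => exact ⟨C (n : ℝ), fun t => by simp⟩
    | add a b _ _ ha hb =>
      obtain ⟨p, hp⟩ := ha
      obtain ⟨q, hq⟩ := hb
      exact ⟨p + q, fun t => by rw [eval_add, hp, hq, map_add]⟩
    | mul a b _ _ ha hb =>
      obtain ⟨p, hp⟩ := ha
      obtain ⟨q, hq⟩ := hb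
      exact ⟨p * q, fun t => by rw [eval_mul, hp, hq, map_mul]⟩
  choose P hP using h
  refine ⟨{ toFun := P, map_one' := ?_, map_mul' := ?_, map_zero' := ?_, map_add' := ?_,
            commutes' := ?_ }, fun t a => hP a t⟩
  · exact eq_of_eval_natCast_eq fun t => by rw [hP, map_one, eval_one]
  · exact fun a b => eq_of_eval_natCast_eq fun t => by rw [hP, map_mul, eval_mul, hP, hP]
  · exact eq_of_eval_natCast_eq fun t => by rw [hP, map_zero, eval_zero]
  · exact fun a b => eq_of_eval_natCast_eq fun t => by rw [hP, map_add, eval_add, hP, hP]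
  · exact fun n => eq_of_eval_natCast_eq fun t => by
      rw [hP, AlgHom.commutes]
      simp

/-- Real points of a unipotent group have `r`-th roots, and the root is given by the binomial
series in the matrix representation. -/
theorem exists_pow_eq_and_pointRep_eq (hG : IsUnipotentZGroup A) (hM : IsMatrixRep ℚ M)
    (hs : IsGeneratingRep M s) (x : GPoints A ℝ) {r : ℕ} (hr : r ≠ 0) :
    ∃ y : GPoints A ℝ, y ^ r = x ∧
      pointRep ℝ hM y = unipotentPow (pointRep ℝ hM x) ((r : ℚ)⁻¹ : ℚ) := by
  obtain ⟨P, hP⟩ := exists_polynomial_interpolation hG hM hs x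
  have hu := hG.2.pointRep_sub_one_pow_eq_zero (R := ℝ) hM x
  let y : ℝ → GPoints A ℝ := fun t =>
    WithConv.toConv ((((aeval t : ℝ[X] →ₐ[ℝ] ℝ).restrictScalars ℚ).restrictScalars ℤ).comp P)
  have hy : ∀ t i j, pointRep ℝ hM (y t) i j = (genericExtension P (M i j)).eval t := by
    intro t i j
    rw [pointRep_apply]
    change genericExtension
      ((((aeval t : ℝ[X] →ₐ[ℝ] ℝ).restrictScalars ℚ).restrictScalars ℤ).comp P) (M i j) = _
    exact DFunLike.congr_fun
      (genericExtension_comp ((aeval t : ℝ[X] →ₐ[ℝ] ℝ).restrictScalars ℚ) P) (M i j)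
  have hyn : ∀ t : ℕ, y t = x ^ t := fun t => by
    refine WithConv.ofConv_injective ?_
    ext a
    rw [← hP]
    rfl
  have hpoly : ∀ i j, genericExtension P (M i j) = unipotentPowPoly (pointRep ℝ hM x) i j :=
    fun i j => eq_of_eval_natCast_eq fun t => by
      rw [← hy, hyn, map_pow, ← unipotentPow_apply, unipotentPow_natCast hu]
  have hyt : ∀ t, pointRep ℝ hM (y t) = unipotentPow (pointRep ℝ hM x) t := fun t => by
    ext i j
    rw [hy, hpoly, unipotentPow_apply]
  refine ⟨y ((r : ℚ)⁻¹ : ℚ), hs.pointRep_injective hM ?_, hyt _⟩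
  rw [map_pow, hyt, unipotentPow_pow hu, Rat.cast_inv, Rat.cast_natCast,
    mul_inv_cancel₀ (Nat.cast_ne_zero.2 hr), unipotentPow_one hu]

end UnipotentPow

/-! ### Denominators -/

section Denominators

theorem exists_common_denominator {ι : Type*} [Fintype ι] (c : ι → ℚ) :
    ∃ d : ℕ, d ≠ 0 ∧ ∀ i, ∃ z : ℤ, (d : ℝ) * (c i : ℝ) = z := by
  refine ⟨∏ i, (c i).den, Finset.prod_ne_zero_iff.2 fun i _ => (c i).den_ne_zero, fun i => ?_⟩
  obtain ⟨e, he⟩ := Finset.dvd_prod_of_mem (fun i => (c i).den) (Finset.mem_univ i)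
  refine ⟨e * (c i).num, ?_⟩
  have h : ((c i).den : ℚ) * c i = (c i).num := Rat.den_mul_eq_num (c i)
  have h' : ((c i).den : ℝ) * (c i : ℝ) = (c i).num := by
    exact_mod_cast congrArg (Rat.cast : ℚ → ℝ) h
  rw [he]
  push_cast
  rw [mul_right_comm, h', mul_comm]

/-- The real matrices with integral entries. -/
def integralMatrices (m : ℕ) : Subring (Matrix (Fin m) (Fin m) ℝ) :=
  (Int.castRingHom ℝ).mapMatrix.range

variable {m : ℕ}

theorem mem_integralMatrices {X : Matrix (Fin m) (Fin m) ℝ} :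
    X ∈ integralMatrices m ↔ ∀ i j, ∃ z : ℤ, X i j = z := by
  constructor
  · rintro ⟨Z, rfl⟩ i j
    exact ⟨Z i j, rfl⟩
  · intro h
    choose Z hZ using h
    exact ⟨Z, by ext i j; exact (hZ i j).symm⟩

theorem natCast_smul_mem_integralMatrices {X : Matrix (Fin m) (Fin m) ℝ}
    (hX : X ∈ integralMatrices m) (n : ℕ) : (n : ℝ) • X ∈ integralMatrices m := by
  rw [Nat.cast_smul_eq_nsmul]
  exact nsmul_mem hX n

theorem intCast_smul_mem_integralMatrices {X : Matrix (Fin m) (Fin m) ℝ}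
    (hX : X ∈ integralMatrices m) (n : ℤ) : (n : ℝ) • X ∈ integralMatrices m := by
  rw [Int.cast_smul_eq_zsmul]
  exact zsmul_mem hX n

/-- The `r`-th roots of unipotent matrices of bounded denominator have bounded denominator. -/
theorem exists_denominator_of_pow (m : ℕ) {N r : ℕ} (hN : N ≠ 0) (hr : r ≠ 0) :
    ∃ N' : ℕ, N' ≠ 0 ∧ ∀ u : Matrix (Fin m) (Fin m) ℝ, (u - 1) ^ m = 0 → (u ^ r - 1) ^ m = 0 →
      (N : ℝ) • u ^ r ∈ integralMatrices m → (N' : ℝ) • u ∈ integralMatrices m := by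
  obtain ⟨d, hd, hdc⟩ := exists_common_denominator
    fun k : Fin (m + 1) => (binomPoly k).eval ((r : ℚ)⁻¹)
  refine ⟨d * N ^ m, mul_ne_zero hd (pow_ne_zero _ hN), fun u hu hur hz => ?_⟩
  rw [← unipotentPow_pow_inv hu hr hur, unipotentPow_eq_sum, Finset.smul_sum]
  refine sum_mem fun k hk => ?_
  obtain ⟨z, hz'⟩ := hdc ⟨k, Finset.mem_range.1 hk⟩
  have hk' : k ≤ m := Nat.lt_succ_iff.1 (Finset.mem_range.1 hk)
  have h1 : (N : ℝ) • (u ^ r - 1) ∈ integralMatrices m := by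
    rw [smul_sub]
    exact sub_mem hz (natCast_smul_mem_integralMatrices (one_mem _) N)
  have h2 : (((d * N ^ m : ℕ) : ℝ) • (((binomPoly k).eval ((r : ℚ)⁻¹) : ℚ) : ℝ) • (u ^ r - 1) ^ k) =
      (z : ℝ) • ((N ^ (m - k) : ℕ) : ℝ) • ((N : ℝ) • (u ^ r - 1)) ^ k := by
    rw [smul_pow, smul_smul, smul_smul, smul_smul, ← hz']
    congr 1
    push_cast
    rw [← pow_sub_mul_pow (N : ℝ) hk']
    ring
  rw [h2]
  exact intCast_smul_mem_integralMatrices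
    (natCast_smul_mem_integralMatrices (pow_mem h1 k) _) z

/-- The `r`-th root of a matrix that is sufficiently congruent to `1` is congruent to `1`: the
factor `K` absorbs the denominators of the binomial coefficients. -/
theorem exists_congruence_of_root (m : ℕ) (D : ℕ) (hD : D ≠ 0) (r : ℕ) :
    ∃ K : ℕ, K ≠ 0 ∧ ∀ u : Matrix (Fin m) (Fin m) ℝ,
      (∃ Y ∈ integralMatrices m, u - 1 = (K : ℝ) • Y) →
      ∃ Y ∈ integralMatrices m, unipotentPow u ((r : ℚ)⁻¹ : ℚ) - 1 = (D : ℝ) • Y := by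
  obtain ⟨d, hd, hdc⟩ := exists_common_denominator
    fun k : Fin (m + 1) => (binomPoly k).eval ((r : ℚ)⁻¹)
  refine ⟨d * D, mul_ne_zero hd hD, ?_⟩
  rintro u ⟨Y, hY, hu⟩
  choose z hz using hdc
  refine ⟨∑ k : Fin m, (z k.succ : ℝ) • (((d * D) ^ (k : ℕ) : ℕ) : ℝ) • Y ^ ((k : ℕ) + 1),
    sum_mem fun k _ => intCast_smul_mem_integralMatrices
      (natCast_smul_mem_integralMatrices (pow_mem hY _) _) _, ?_⟩
  rw [unipotentPow_eq_sum, Finset.sum_range_succ', binomPoly_zero, Polynomial.eval_one, pow_zero,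
    Rat.cast_one, one_smul, add_sub_cancel_right, Finset.sum_range, Finset.smul_sum]
  refine Finset.sum_congr rfl fun k _ => ?_
  have h := hz k.succ
  rw [Fin.val_succ] at h
  rw [hu, smul_pow, smul_smul, smul_smul, smul_smul, ← h]
  congr 1
  push_cast
  ring

variable {A : Type*} [CommSemiring A] [HopfAlgebra ℤ A]
  {M : Matrix (Fin m) (Fin m) (ℚ ⊗[ℤ] A)} {s : Finset A}

theorem exists_denominator_genericExtension (b : ℚ ⊗[ℤ] A) :
    ∃ N : ℕ, N ≠ 0 ∧ ∀ x ∈ integralPoints A, ∃ z : ℤ,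
      (N : ℝ) * genericExtension x.ofConv b = z := by
  induction b with
  | zero => exact ⟨1, one_ne_zero, fun x _ => ⟨0, by simp⟩⟩
  | tmul q a =>
    refine ⟨q.den, q.den_ne_zero, ?_⟩
    rintro _ ⟨h, rfl⟩
    refine ⟨q.num * h.ofConv a, ?_⟩
    have h1 : (q.den : ℝ) * (q : ℝ) = q.num := by
      exact_mod_cast congrArg (Rat.cast : ℚ → ℝ) (Rat.den_mul_eq_num q)
    rw [genericExtension_tmul, eq_ratCast, ← mul_assoc, h1, Int.cast_mul]
    rfl
  | add b c hb hc =>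
    obtain ⟨N, hN, h⟩ := hb
    obtain ⟨N', hN', h'⟩ := hc
    refine ⟨N * N', mul_ne_zero hN hN', fun x hx => ?_⟩
    obtain ⟨z, hz⟩ := h x hx
    obtain ⟨z', hz'⟩ := h' x hx
    refine ⟨N' * z + N * z', ?_⟩
    push_cast
    rw [← hz, ← hz', map_add]
    ring

/-- The matrices of the integral points have bounded denominator. -/
theorem exists_denominator_integralPoints (hM : IsMatrixRep ℚ M) :
    ∃ N : ℕ, N ≠ 0 ∧ ∀ x ∈ integralPoints A, (N : ℝ) • pointRep ℝ hM x ∈ integralMatrices m := by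
  choose N hN h using fun p : Fin m × Fin m =>
    exists_denominator_genericExtension (M p.1 p.2)
  refine ⟨∏ p, N p, Finset.prod_ne_zero_iff.2 fun p _ => hN p, fun x hx => ?_⟩
  refine mem_integralMatrices.2 fun i j => ?_
  obtain ⟨z, hz⟩ := h (i, j) x hx
  obtain ⟨e, he⟩ := Finset.dvd_prod_of_mem N (Finset.mem_univ (i, j))
  refine ⟨e * z, ?_⟩
  rw [Matrix.smul_apply, smul_eq_mul, he, pointRep_apply]
  push_cast
  rw [← hz]
  ring

theorem mem_integralPoints_of_forall_mem (hs : Algebra.adjoin ℤ (s : Set A) = ⊤)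
    {x : GPoints A ℝ} (h : ∀ a ∈ s, ∃ z : ℤ, x.ofConv a = z) : x ∈ integralPoints A := by
  have hinj : Function.Injective (algebraMap ℤ ℝ) := Int.cast_injective
  have hr : ∀ a, x.ofConv a ∈ (⊥ : Subalgebra ℤ ℝ) := by
    intro a
    have ha : a ∈ (⊥ : Subalgebra ℤ ℝ).comap x.ofConv := by
      have h1 : Algebra.adjoin ℤ (s : Set A) ≤ (⊥ : Subalgebra ℤ ℝ).comap x.ofConv :=
        Algebra.adjoin_le fun a ha => by
          obtain ⟨z, hz⟩ := h a ha
          exact Algebra.mem_bot.2 ⟨z, hz.symm⟩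
      exact h1 (hs ▸ Algebra.mem_top)
    exact ha
  refine ⟨WithConv.toConv ((Algebra.botEquivOfInjective hinj).toAlgHom.comp
    (x.ofConv.codRestrict ⊥ hr)), WithConv.ofConv_injective ?_⟩
  ext a
  obtain ⟨z, hz⟩ := Algebra.mem_bot.1 (hr a)
  have h2 : x.ofConv.codRestrict ⊥ hr a = algebraMap ℤ (⊥ : Subalgebra ℤ ℝ) z :=
    Subtype.ext hz.symm
  change x.ofConv a = algebraMap ℤ ℝ (Algebra.botEquivOfInjective hinj
    (x.ofConv.codRestrict ⊥ hr a))
  rw [h2, AlgEquiv.commutes, ← hz]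
  rfl

/-- A congruence subgroup consists of integral points. -/
theorem exists_congruence_mem_integralPoints (hM : IsMatrixRep ℚ M) (hs : IsGeneratingRep M s) :
    ∃ D : ℕ, D ≠ 0 ∧ ∀ x : GPoints A ℝ,
      (∃ Y ∈ integralMatrices m, pointRep ℝ hM x - 1 = (D : ℝ) • Y) → x ∈ integralPoints A := by
  choose c hc using fun a : s => hs.exists_apply_eq_sum (R := ℝ) hM a.2
  obtain ⟨D, hD, hDc⟩ := exists_common_denominator
    fun q : s × (Fin m × Fin m) => c q.1 q.2
  refine ⟨D, hD, ?_⟩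
  rintro x ⟨Y, hY, hx⟩
  refine mem_integralPoints_of_forall_mem hs.1 fun a ha => ?_
  choose z hz using fun p => hDc (⟨a, ha⟩, p)
  choose y hy using mem_integralMatrices.1 hY
  -- The value at the neutral element is an integer, and the difference is a sum of integers.
  have h1 : x.ofConv a - (1 : GPoints A ℝ).ofConv a = ∑ p, (z p : ℝ) * y p.1 p.2 := by
    rw [hc ⟨a, ha⟩ x, hc ⟨a, ha⟩ 1, ← Finset.sum_sub_distrib]
    refine Finset.sum_congr rfl fun p _ => ?_
    have h2 := congrFun (congrFun hx p.1) p.2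
    rw [Matrix.sub_apply, Matrix.smul_apply, smul_eq_mul, hy] at h2
    rw [map_one, ← mul_sub, h2, ← hz p, eq_ratCast]
    ring
  refine ⟨Coalgebra.counit (R := ℤ) a + ∑ p, z p * y p.1 p.2, ?_⟩
  rw [sub_eq_iff_eq_add'] at h1
  rw [h1]
  push_cast
  rfl

/-- There are only finitely many subgroups of a given commensurability index with `G(ℤ)`: they all
contain a fixed congruence subgroup, consist of points of a fixed denominator, and are therefore
determined by the residues of their elements. -/
theorem IsUnipotentZGroup.finite_commIndex_eq (hG : IsUnipotentZGroup A) {n : ℕ} (hn : n ≠ 0) :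
    {Δ : Subgroup (GPoints A ℝ) | commIndex (integralPoints A) Δ = n}.Finite := by
  have := hG.1
  obtain ⟨m, M, s, hM, hs⟩ := exists_isGeneratingRep (A := A)
  have hr : n.factorial ≠ 0 := n.factorial_ne_zero
  obtain ⟨N₀, hN₀, hL⟩ := exists_denominator_integralPoints hM
  obtain ⟨N, hN, hroot⟩ := exists_denominator_of_pow m hN₀ hr
  obtain ⟨D, hD, hcong⟩ := exists_congruence_mem_integralPoints hM hs
  obtain ⟨K, hK, hKD⟩ := exists_congruence_of_root m D hD n.factorial
  have hpow : ∀ {H₁ H₂ : Subgroup (GPoints A ℝ)}, H₂.relIndex H₁ ∣ n → ∀ x ∈ H₁,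
      x ^ n.factorial ∈ H₂ := by
    intro H₁ H₂ h x hx
    refine (Subgroup.pow_mem_of_relIndex_ne_zero_of_dvd (ne_zero_of_dvd_ne_zero hn h) hx
      fun k hk hk' => Nat.dvd_factorial hk ?_).1
    exact hk'.trans (Nat.le_of_dvd (Nat.pos_of_ne_zero hn) h)
  have hupper : ∀ Δ : Subgroup (GPoints A ℝ), commIndex (integralPoints A) Δ = n → ∀ x ∈ Δ,
      (N : ℝ) • pointRep ℝ hM x ∈ integralMatrices m := by
    intro Δ hΔ x hx
    have hx' := hpow (Dvd.intro_left _ hΔ) x hx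
    refine hroot _ (hG.2.pointRep_sub_one_pow_eq_zero hM x) ?_ ?_
    · rw [← map_pow]
      exact hG.2.pointRep_sub_one_pow_eq_zero hM _
    · rw [← map_pow]
      exact hL _ hx'
  have hlower : ∀ Δ : Subgroup (GPoints A ℝ), commIndex (integralPoints A) Δ = n →
      ∀ x : GPoints A ℝ, (∃ Y ∈ integralMatrices m, pointRep ℝ hM x - 1 = (K : ℝ) • Y) →
      x ∈ Δ := by
    intro Δ hΔ x hx
    obtain ⟨y, rfl, hy⟩ := exists_pow_eq_and_pointRep_eq hG hM hs x hr
    refine hpow (Dvd.intro _ hΔ) y (hcong y ?_)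
    rw [hy]
    exact hKD _ hx
  let Q := N * N * K
  have : NeZero Q := ⟨mul_ne_zero (mul_ne_zero hN hN) hK⟩
  let res : GPoints A ℝ → Matrix (Fin m) (Fin m) (ZMod Q) := fun x i j =>
    ((⌊(N : ℝ) * pointRep ℝ hM x i j⌋ : ℤ) : ZMod Q)
  -- Points of denominator `N` with the same residues differ by an element of the lower bound.
  have hle : ∀ Δ₁ Δ₂ : Subgroup (GPoints A ℝ), commIndex (integralPoints A) Δ₁ = n →
      commIndex (integralPoints A) Δ₂ = n → res '' Δ₁ = res '' Δ₂ → Δ₁ ≤ Δ₂ := by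
    intro Δ₁ Δ₂ h₁ h₂ h x hx
    obtain ⟨y, hy, hxy⟩ : res x ∈ res '' Δ₂ := h ▸ ⟨x, hx, rfl⟩
    suffices hmem : x * y⁻¹ ∈ Δ₂ by simpa using mul_mem hmem hy
    choose X hX using mem_integralMatrices.1 (hupper Δ₁ h₁ x hx)
    choose Y hY using mem_integralMatrices.1 (hupper Δ₂ h₂ y hy)
    have hdvd : ∀ i j, ∃ w : ℤ, X i j - Y i j = Q * w := by
      intro i j
      have h3 := congrFun (congrFun hxy i) j
      have hX' := hX i j
      have hY' := hY i j
      rw [Matrix.smul_apply, smul_eq_mul] at hX' hY'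
      simp only [res] at h3
      rw [hX', hY', Int.floor_intCast, Int.floor_intCast, ZMod.intCast_eq_intCast_iff_dvd_sub] at h3
      exact h3
    obtain ⟨W, hW⟩ : ∃ W : Matrix (Fin m) (Fin m) ℤ, ∀ i j, X i j - Y i j = Q * W i j := by
      choose W hW using hdvd
      exact ⟨W, hW⟩
    have hWmem : (W.map (Int.cast : ℤ → ℝ) : Matrix (Fin m) (Fin m) ℝ) ∈ integralMatrices m :=
      ⟨W, rfl⟩
    have hNR : (N : ℝ) ≠ 0 := Nat.cast_ne_zero.2 hN
    have hdiff : pointRep ℝ hM x - pointRep ℝ hM y =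
        ((N * K : ℕ) : ℝ) • W.map (Int.cast : ℤ → ℝ) := by
      ext i j
      have hX' := hX i j
      have hY' := hY i j
      have hW' : (X i j : ℝ) - Y i j = (Q : ℝ) * W i j := by exact_mod_cast hW i j
      rw [← hX', ← hY'] at hW'
      simp only [Matrix.smul_apply, smul_eq_mul, Q] at hW'
      simp only [Matrix.sub_apply, Matrix.smul_apply, smul_eq_mul, Matrix.map_apply]
      push_cast at hW' ⊢
      refine mul_left_cancel₀ hNR ?_
      linarith
    refine hlower Δ₂ h₂ _ ⟨W.map (Int.cast : ℤ → ℝ) * ((N : ℝ) • pointRep ℝ hM y⁻¹),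
      mul_mem hWmem (hupper Δ₂ h₂ _ (inv_mem hy)), ?_⟩
    have h4 : pointRep ℝ hM (x * y⁻¹) - 1 =
        (pointRep ℝ hM x - pointRep ℝ hM y) * pointRep ℝ hM y⁻¹ := by
      rw [sub_mul, ← map_mul, ← map_mul, mul_inv_cancel, map_one]
    rw [h4, hdiff, Matrix.mul_smul, smul_smul, Matrix.smul_mul]
    congr 1
    push_cast
    ring
  refine Set.Finite.of_finite_image (f := fun Δ : Subgroup (GPoints A ℝ) =>
    res '' (Δ : Set (GPoints A ℝ))) (Set.toFinite _) ?_
  intro Δ₁ h₁ Δ₂ h₂ h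
  exact le_antisymm (hle Δ₁ Δ₂ h₁ h₂ h) (hle Δ₂ Δ₁ h₂ h₁ h.symm)

end Denominators

/-! ### Counting arithmetic lattices -/

section Counting

variable {A : Type*} [CommSemiring A] [HopfAlgebra ℤ A]

theorem mem_arithmeticLattices_of_commIndex_eq {Δ : Subgroup (GPoints A ℝ)} {n : ℕ} (hn : n ≠ 0)
    (h : commIndex (integralPoints A) Δ = n) : Δ ∈ arithmeticLattices A :=
  commIndex_ne_zero_iff.1 (h ▸ hn)

theorem commCount_arithmeticLattices {n : ℕ} (hn : n ≠ 0) :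
    commCount (arithmeticLattices A) n =
      Nat.card {Δ : Subgroup (GPoints A ℝ) // commIndex (integralPoints A) Δ = n} := by
  rw [commCount, ← Nat.card_coe_set_eq]
  exact Nat.card_congr (Equiv.subtypeEquivRight fun Δ =>
    ⟨fun h => h.2, fun h => ⟨mem_arithmeticLattices_of_commIndex_eq hn h, h⟩⟩)

theorem commZeta_apply (F : Set (Subgroup (GPoints A ℝ))) {n : ℕ} (hn : n ≠ 0) :
    commZeta F n = commCount F n := if_neg hn

theorem IsUnipotentZGroup.isMultiplicative_commZeta (hG : IsUnipotentZGroup A) :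
    (commZeta (arithmeticLattices A)).IsMultiplicative := by
  have := hG.isNilpotent ℝ
  refine ArithmeticFunction.IsMultiplicative.iff_ne_zero.2 ⟨?_, fun {a b} ha hb hab => ?_⟩
  · rw [commZeta_apply _ one_ne_zero, commCount_arithmeticLattices one_ne_zero]
    simp only [commIndex_eq_one_iff]
    exact Nat.card_unique
  · rw [commZeta_apply _ ha, commZeta_apply _ hb, commZeta_apply _ (mul_ne_zero ha hb),
      commCount_arithmeticLattices ha, commCount_arithmeticLattices hb,
      commCount_arithmeticLattices (mul_ne_zero ha hb), card_commIndex_mul _ ha hb hab]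

end Counting

theorem mainTheorem2 (A : Type*) [CommSemiring A] [HopfAlgebra ℤ A] (hG : IsUnipotentZGroup A) :
    (∀ n : ℕ, n ≠ 0 →
      {Δ | Δ ∈ arithmeticLattices A ∧ commIndex (integralPoints A) Δ = n}.Finite) ∧
    IsFormalPrimeProduct (fun p => commZeta (localLattices A p))
      (commZeta (arithmeticLattices A)) ∧
    ∀ n : ℕ, n ≠ 0 → commCount (arithmeticLattices A) n =
      ∏ p ∈ n.primeFactors, commCount (arithmeticLattices A) (p ^ n.factorization p) := by
  refine ⟨fun n hn => (hG.finite_commIndex_eq hn).subset fun Δ h => h.2,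
    isFormalPrimeProduct_of_isMultiplicative hG.isMultiplicative_commZeta ?_ ?_, fun n hn => ?_⟩
  · intro p k
    have hpk : (p : ℕ) ^ k ≠ 0 := pow_ne_zero k p.2.ne_zero
    rw [commZeta_apply _ hpk, commZeta_apply _ hpk, commCount, commCount]
    congr 1
    ext Δ
    exact ⟨fun h => ⟨h.1.1, h.2⟩, fun h => ⟨⟨h.1, k, h.2⟩, h.2⟩⟩
  · intro p n hn
    rcases eq_or_ne n 0 with rfl | h0
    · exact ArithmeticFunction.map_zero
    rw [commZeta_apply _ h0, commCount]
    convert Set.ncard_empty (Subgroup (GPoints A ℝ))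
    refine Set.eq_empty_of_forall_notMem fun Δ h => ?_
    obtain ⟨⟨-, k, hk⟩, h⟩ := h
    exact hn k (h ▸ hk)
  · have h := hG.isMultiplicative_commZeta.multiplicative_factorization _ hn
    rw [commZeta_apply _ hn] at h
    rw [h, Finsupp.prod, Nat.support_factorization]
    exact Finset.prod_congr rfl fun p hp =>
      commZeta_apply _ (pow_ne_zero _ (Nat.prime_of_mem_primeFactors hp).ne_zero)
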